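/- Let $\sigma,\tau$ be independent uniformly random involutions of $[n]=\{1,\dots,n\}$ (an involution is a permutation all of whose cycles have length $1$ or $2$; the identity is included). Regard $\sigma$ and $\tau$ as partial matchings of $[n]$, and let $\sigma\cup\tau$ be their superposition: the graph on $[n]$ with a solid edge $xy$ for every $2$-cycle $(x\,y)$ of $\sigma$ and a dotted edge $xy$ for every $2$-cycle $(x\,y)$ of $\tau$. Its connected components are paths (a single vertex counts as a path) and cycles (two vertices joined by both a solid and a dotted edge count as a cycle). As $n\to\infty$: 1. the expected number of cycles, of all lengths including $1$, of the permutation $\tau\circ\sigma$ is $\sqrt n+\tfrac12\log n+O(1)$; 2. the expected number of connected components of $\sigma\cup\tau$ that are paths is $\sqrt n+O(1)$; 3. the expected number of connected components of $\sigma\cup\tau$ that are cycles is $\tfrac14\log n-\tfrac12\log 2+O(n^{-1/2}\log n)$; in particular it is $\tfrac14\log n+O(1)$. -/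

import Mathlib

open Filter Asymptotics

/-- The involutions of `{0, …, n-1}` (the identity included), i.e. the partial matchings of this
set: `x` and `y ≠ x` are matched when `σ x = y`, and `x` is unmatched when `σ x = x`. -/
def involutions (n : ℕ) : Finset (Equiv.Perm (Fin n)) :=
  {σ | ∀ x, σ (σ x) = x}

/-- The expectation of `X σ τ` for two independent uniformly random involutions `σ, τ`. -/
noncomputable def pairMean (n : ℕ) (X : Equiv.Perm (Fin n) → Equiv.Perm (Fin n) → ℕ) : ℝ :=
  (∑ σ ∈ involutions n, ∑ τ ∈ involutions n, (X σ τ : ℝ)) /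
    ((involutions n).card : ℝ) ^ 2

/-- The number of cycles of a permutation, of all lengths (fixed points are cycles of length 1). -/
noncomputable def numPermCycles {n : ℕ} (π : Equiv.Perm (Fin n)) : ℕ :=
  Nat.card (Quotient (Equiv.Perm.SameCycle.setoid π))

/-- The number (0, 1 or 2) of coloured edges between `x` and `y` in the superposition of the
partial matchings `σ` and `τ`: one solid edge for each matched pair of `σ`, one dotted edge for
each matched pair of `τ`, and no loops. -/
def edgeMult {n : ℕ} (σ τ : Equiv.Perm (Fin n)) (x y : Fin n) : ℕ :=
  (if x ≠ y ∧ σ x = y then 1 else 0) + (if x ≠ y ∧ τ x = y then 1 else 0)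

/-- The simple graph underlying the superposition of `σ` and `τ`; its connected components are the
components of the superposition. -/
def superposition {n : ℕ} (σ τ : Equiv.Perm (Fin n)) : SimpleGraph (Fin n) :=
  SimpleGraph.fromRel fun x y => 0 < edgeMult σ τ x y

/-- A component of the superposition is a path if its vertices can be listed without repetition as
`v₀, …, v_{k-1}` so that one coloured edge joins `v_i` and `v_{i+1}` for each `i < k - 1`, and the
component has no other edges. A single vertex is a path. -/
def IsPathComponent {n : ℕ} (σ τ : Equiv.Perm (Fin n))
    (C : (superposition σ τ).ConnectedComponent) : Prop :=
  ∃ (k : ℕ) (v : Fin k → Fin n), Function.Injective v ∧ Set.range v = C.supp ∧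
    ∀ i j : Fin k, edgeMult σ τ (v i) (v j) =
      if i.val + 1 = j.val ∨ j.val + 1 = i.val then 1 else 0

/-- A component of the superposition is a cycle if its vertices can be listed without repetition as
`v₀, …, v_{k-1}`, with `k ≥ 2`, so that its coloured edges are exactly one edge from `v_i` to
`v_{i+1}` for each `i`, indices modulo `k`. For `k = 2` this is the degenerate cycle: two vertices
joined by a solid and a dotted edge. -/
def IsCycleComponent {n : ℕ} (σ τ : Equiv.Perm (Fin n))
    (C : (superposition σ τ).ConnectedComponent) : Prop :=
  ∃ (k : ℕ) (v : Fin k → Fin n), 2 ≤ k ∧ Function.Injective v ∧ Set.range v = C.supp ∧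
    ∀ i j : Fin k, edgeMult σ τ (v i) (v j) =
      (if finRotate k i = j then 1 else 0) + (if finRotate k j = i then 1 else 0)

/-- The number of components of the superposition of `σ` and `τ` that are paths. -/
noncomputable def numPaths {n : ℕ} (σ τ : Equiv.Perm (Fin n)) : ℕ :=
  Nat.card {C : (superposition σ τ).ConnectedComponent // IsPathComponent σ τ C}

/-- The number of components of the superposition of `σ` and `τ` that are cycles. -/
noncomputable def numCycles {n : ℕ} (σ τ : Equiv.Perm (Fin n)) : ℕ :=
  Nat.card {C : (superposition σ τ).ConnectedComponent // IsCycleComponent σ τ C}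

/-! At every vertex, the degree plus the number of involutions fixing it is 2. So a path component
carries exactly two fixed points of `σ` and `τ` (with multiplicity) and a cycle component none, and
twice the number of paths is the total number of fixed points (`two_mul_numPaths`). A path is one
cycle of `τ * σ`, while a cycle component splits into two (`numPermCycles_mul`), so item 1 follows
from items 2 and 3.

Write t(n) for the number of involutions. The mean number of paths is n t(n-1) / t(n), and √(m+1) ≤
t(m+1)/t(m) ≤ √(m+1) + 1 gives item 2. For item 3, a cycle on 2k vertices has 2k alternating
listings that begin with a solid edge, and prescribing a listing leaves both involutions free on n -
2k points. The mean is therefore the sum of w_k / (2k) with w_k = n(n-1)⋯(n-2k+1) t(n-2k)² / t(n)²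
(`pairMean_numCycles`). The quotients w_{k+1}/w_k are 1 - 2/√(n-2k) + O(1/(n-2k)), so w_k is close
to z^k with z = 1 - 2/√n on the range k = O(√n) that matters. The sum is then about -½ log(1 - z) =
½ log(√n / 2) = ¼ log n - ½ log 2. The error obtained is O(n^{-1/2}), sharper than stated. -/

section Components

variable {n : ℕ} {σ τ : Equiv.Perm (Fin n)}

/-! ### Components and their fixed points -/

theorem edgeMult_comm_perm (σ τ : Equiv.Perm (Fin n)) (x y : Fin n) :
    edgeMult σ τ x y = edgeMult τ σ x y := by
  simp only [edgeMult]; omega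

theorem superposition_adj (hσ : ∀ x, σ (σ x) = x) (hτ : ∀ x, τ (τ x) = x) {x y : Fin n} :
    (superposition σ τ).Adj x y ↔ x ≠ y ∧ (σ x = y ∨ τ x = y) := by
  have h1 : σ y = x ↔ σ x = y :=
    ⟨fun h => by rw [← h, hσ], fun h => by rw [← h, hσ]⟩
  have h2 : τ y = x ↔ τ x = y :=
    ⟨fun h => by rw [← h, hτ], fun h => by rw [← h, hτ]⟩
  simp only [superposition, SimpleGraph.fromRel_adj, edgeMult, h1, h2, ne_comm (a := y)]
  by_cases a : x = y <;> by_cases b : σ x = y <;> by_cases c : τ x = y <;> simp [a, b, c]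

theorem reachable_apply_left (hσ : ∀ x, σ (σ x) = x) (hτ : ∀ x, τ (τ x) = x) (x : Fin n) :
    (superposition σ τ).Reachable x (σ x) := by
  by_cases h : x = σ x
  · rw [← h]
  · exact ((superposition_adj hσ hτ).2 ⟨h, Or.inl rfl⟩).reachable

theorem reachable_apply_right (hσ : ∀ x, σ (σ x) = x) (hτ : ∀ x, τ (τ x) = x) (x : Fin n) :
    (superposition σ τ).Reachable x (τ x) := by
  by_cases h : x = τ x
  · rw [← h]
  · exact ((superposition_adj hσ hτ).2 ⟨h, Or.inr rfl⟩).reachable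

theorem mem_of_reachable (hσ : ∀ x, σ (σ x) = x) (hτ : ∀ x, τ (τ x) = x) {S : Set (Fin n)}
    (hSσ : ∀ x ∈ S, σ x ∈ S) (hSτ : ∀ x ∈ S, τ x ∈ S) {x y : Fin n}
    (h : (superposition σ τ).Reachable x y) (hx : x ∈ S) : y ∈ S := by
  obtain ⟨p⟩ := h
  induction p with
  | nil => exact hx
  | cons hadj _ ih =>
    rcases ((superposition_adj hσ hτ).1 hadj).2 with h | h
    · exact ih (h ▸ hSσ _ hx)
    · exact ih (h ▸ hSτ _ hx)

theorem apply_left_mem_supp (hσ : ∀ x, σ (σ x) = x) (hτ : ∀ x, τ (τ x) = x)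
    (C : (superposition σ τ).ConnectedComponent) {x : Fin n} (hx : x ∈ C.supp) :
    σ x ∈ C.supp := by
  rw [SimpleGraph.ConnectedComponent.mem_supp_iff] at hx ⊢
  rw [← hx]
  exact SimpleGraph.ConnectedComponent.sound (reachable_apply_left hσ hτ x).symm

theorem apply_right_mem_supp (hσ : ∀ x, σ (σ x) = x) (hτ : ∀ x, τ (τ x) = x)
    (C : (superposition σ τ).ConnectedComponent) {x : Fin n} (hx : x ∈ C.supp) :
    τ x ∈ C.supp := by
  rw [SimpleGraph.ConnectedComponent.mem_supp_iff] at hx ⊢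
  rw [← hx]
  exact SimpleGraph.ConnectedComponent.sound (reachable_apply_right hσ hτ x).symm

/-- The number of the two permutations `σ`, `τ` that fix `x`. -/
def fixMult (σ τ : Equiv.Perm (Fin n)) (x : Fin n) : ℕ :=
  (if σ x = x then 1 else 0) + (if τ x = x then 1 else 0)

/-- Each involution either fixes `x` or gives it exactly one edge. -/
theorem sum_edgeMult_add_fixMult {S : Finset (Fin n)} {x : Fin n}
    (h1 : σ x ∈ S) (h2 : τ x ∈ S) : ∑ y ∈ S, edgeMult σ τ x y + fixMult σ τ x = 2 := by
  have key : ∀ ρ : Equiv.Perm (Fin n), ρ x ∈ S →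
      ∑ y ∈ S, (if x ≠ y ∧ ρ x = y then 1 else 0) + (if ρ x = x then 1 else 0) = 1 := by
    intro ρ hρ
    rw [Finset.sum_eq_single_of_mem _ hρ]
    · by_cases h : ρ x = x
      · simp [h]
      · simp [h, Ne.symm h]
    · intro y _ hy
      simp [hy.symm]
  have a := key σ h1
  have b := key τ h2
  simp only [edgeMult, fixMult, Finset.sum_add_distrib]
  omega

theorem sum_edgeMult_listing (hσ : ∀ x, σ (σ x) = x) (hτ : ∀ x, τ (τ x) = x)
    {C : (superposition σ τ).ConnectedComponent} {k : ℕ} {v : Fin k → Fin n}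
    (hv : Function.Injective v) (hr : Set.range v = C.supp) :
    ∑ i, ∑ j, edgeMult σ τ (v i) (v j) + ∑ i, fixMult σ τ (v i) = 2 * k := by
  have hi : ∀ i, ∑ j, edgeMult σ τ (v i) (v j) + fixMult σ τ (v i) = 2 := by
    intro i
    have hm : v i ∈ C.supp := hr ▸ Set.mem_range_self i
    have h1 := apply_left_mem_supp hσ hτ C hm
    have h2 := apply_right_mem_supp hσ hτ C hm
    rw [← hr] at h1 h2
    rw [← sum_edgeMult_add_fixMult (S := Finset.univ.image v) (σ := σ) (τ := τ) (x := v i)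
      (by simpa using h1) (by simpa using h2), Finset.sum_image (fun a _ b _ h => hv h)]
  rw [← Finset.sum_add_distrib, Finset.sum_congr rfl fun i _ => hi i]
  simp [mul_comm]

theorem sum_path_adjacency (k : ℕ) :
    ∑ i : Fin (k + 1), ∑ j : Fin (k + 1),
      (if i.val + 1 = j.val ∨ j.val + 1 = i.val then 1 else 0) = 2 * k := by
  have h1 : ∑ i : Fin (k + 1), ∑ j : Fin (k + 1), (if i.val + 1 = j.val then 1 else 0) = k := by
    rw [Fin.sum_univ_castSucc]
    have : ∀ i : Fin k, ∑ j : Fin (k + 1), (if i.castSucc.val + 1 = j.val then 1 else 0) = 1 := by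
      intro i
      rw [Finset.sum_eq_single i.succ]
      · simp
      · intro j _ hj
        rw [if_neg]
        intro h
        exact hj (Fin.ext (by simpa using h.symm))
      · simp
    have h0 : ∑ j : Fin (k + 1), (if (Fin.last k).val + 1 = j.val then 1 else 0) = 0 := by
      refine Finset.sum_eq_zero fun j _ => if_neg ?_
      have := j.isLt
      simp only [Fin.val_last]; omega
    rw [Finset.sum_congr rfl fun i _ => this i, h0]
    simp
  have h2 : ∀ i j : Fin (k + 1), (if i.val + 1 = j.val ∨ j.val + 1 = i.val then 1 else 0) =
      (if i.val + 1 = j.val then 1 else 0) + (if j.val + 1 = i.val then 1 else 0) := by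
    intro i j
    split_ifs <;> omega
  simp only [h2, Finset.sum_add_distrib]
  rw [h1, Finset.sum_comm, h1]; omega

/-- The number of fixed points of `σ` and `τ`, with multiplicity, in a component. -/
noncomputable def componentFix {σ τ : Equiv.Perm (Fin n)}
    (C : (superposition σ τ).ConnectedComponent) : ℕ :=
  open Classical in ∑ x with (superposition σ τ).connectedComponentMk x = C, fixMult σ τ x

theorem componentFix_eq_sum {C : (superposition σ τ).ConnectedComponent} {k : ℕ}
    {v : Fin k → Fin n} (hv : Function.Injective v) (hr : Set.range v = C.supp) :
    componentFix C = ∑ i, fixMult σ τ (v i) := by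
  classical
  rw [componentFix, ← Finset.sum_image (s := Finset.univ) (g := v) (f := fixMult σ τ)
    (fun a _ b _ h => hv h)]
  refine Finset.sum_congr ?_ fun _ _ => rfl
  ext x
  have : x ∈ C.supp ↔ x ∈ Set.range v := by rw [hr]
  simpa using this

/-- Degree count: k + 1 vertices contribute 2(k + 1) in all, and the k edges, counted from both
ends, use up 2k of it. -/
theorem IsPathComponent.componentFix_eq (hσ : ∀ x, σ (σ x) = x) (hτ : ∀ x, τ (τ x) = x)
    {C : (superposition σ τ).ConnectedComponent} (h : IsPathComponent σ τ C) :
    componentFix C = 2 := by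
  obtain ⟨k, v, hv, hr, he⟩ := h
  have h1 := sum_edgeMult_listing hσ hτ hv hr
  rw [componentFix_eq_sum hv hr]
  obtain _ | k := k
  · obtain ⟨x, hx⟩ := C.nonempty_supp
    rw [← hr] at hx
    exact hx.choose.elim0
  · simp only [he, sum_path_adjacency] at h1
    omega

theorem IsCycleComponent.componentFix_eq (hσ : ∀ x, σ (σ x) = x) (hτ : ∀ x, τ (τ x) = x)
    {C : (superposition σ τ).ConnectedComponent} (h : IsCycleComponent σ τ C) :
    componentFix C = 0 := by
  obtain ⟨k, v, -, hv, hr, he⟩ := h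
  have h1 := sum_edgeMult_listing hσ hτ hv hr
  rw [componentFix_eq_sum hv hr]
  have h2 : ∑ i : Fin k, ∑ j : Fin k, (if finRotate k i = j then 1 else 0) = k := by simp
  simp only [he, Finset.sum_add_distrib] at h1
  rw [h2, Finset.sum_comm, h2] at h1
  omega

theorem componentFix_eq_zero_iff {C : (superposition σ τ).ConnectedComponent} :
    componentFix C = 0 ↔ ∀ x ∈ C.supp, σ x ≠ x ∧ τ x ≠ x := by
  simp [componentFix, fixMult, Finset.sum_eq_zero_iff]

/-! ### The alternating walk and the classification of components -/

/-- The walk `x, σ x, τ (σ x), σ (τ (σ x)), …`. -/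
def altSeq (σ τ : Equiv.Perm (Fin n)) (x : Fin n) : ℕ → Fin n
  | 0 => x
  | m + 1 => (if Even m then σ else τ) (altSeq σ τ x m)

theorem altSeq_zero (x : Fin n) : altSeq σ τ x 0 = x := rfl

theorem altSeq_succ (x : Fin n) (m : ℕ) :
    altSeq σ τ x (m + 1) = (if Even m then σ else τ) (altSeq σ τ x m) := rfl

theorem apply_altSeq_succ (hσ : ∀ x, σ (σ x) = x) (hτ : ∀ x, τ (τ x) = x) (x : Fin n) (m : ℕ) :
    (if Even m then σ else τ) (altSeq σ τ x (m + 1)) = altSeq σ τ x m := by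
  rw [altSeq_succ]
  split_ifs
  · exact hσ _
  · exact hτ _

theorem exists_first_return (x : Fin n) :
    ∃ k, Set.InjOn (altSeq σ τ x) (Set.Iic k) ∧ ∃ j ≤ k, altSeq σ τ x (k + 1) = altSeq σ τ x j := by
  classical
  have hex : ∃ m, ∃ j ≤ m, altSeq σ τ x (m + 1) = altSeq σ τ x j := by
    obtain ⟨a, b, hab, hne⟩ := Function.not_injective_iff.1
      (not_injective_infinite_finite (altSeq σ τ x))
    rcases lt_or_gt_of_ne hne with h | h
    · obtain ⟨c, rfl⟩ := Nat.exists_eq_add_of_lt h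
      exact ⟨a + c, a, by omega, hab.symm⟩
    · obtain ⟨c, rfl⟩ := Nat.exists_eq_add_of_lt h
      exact ⟨b + c, b, by omega, hab⟩
  refine ⟨Nat.find hex, ?_, Nat.find_spec hex⟩
  have key : ∀ a b, a < b → b ≤ Nat.find hex → altSeq σ τ x a ≠ altSeq σ τ x b := by
    intro a b hab hb h
    obtain ⟨c, rfl⟩ := Nat.exists_eq_add_of_lt hab
    exact Nat.find_min hex (m := a + c) (by omega) ⟨a, by omega, h.symm⟩
  intro a ha b hb hab
  by_contra hne
  rcases lt_or_gt_of_ne hne with h | h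
  · exact key a b h hb hab
  · exact key b a h ha hab.symm

/-- At its first return the walk stops at a fixed point or closes up. -/
theorem first_return (hσ : ∀ x, σ (σ x) = x) (hτ : ∀ x, τ (τ x) = x) {x : Fin n} {k j : ℕ}
    (hinj : Set.InjOn (altSeq σ τ x) (Set.Iic k)) (hj : j ≤ k)
    (h : altSeq σ τ x (k + 1) = altSeq σ τ x j) :
    altSeq σ τ x (k + 1) = altSeq σ τ x k ∨
      (¬ Even k ∧ altSeq σ τ x (k + 1) = x ∧ τ x = altSeq σ τ x k) := by
  have h1 := apply_altSeq_succ hσ hτ x k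
  rw [h] at h1
  -- With equal parity the same involution leaves positions j and k, so x_{j+1} = x_k, which forces
  -- j = k, since j + 1 = k would break the parity. With opposite parity the step back from j leads
  -- to x_k, so x_{j-1} = x_k contradicts injectivity unless j = 0.
  by_cases hp : Even j ↔ Even k
  · have h2 : altSeq σ τ x (j + 1) = altSeq σ τ x k := by
      rw [altSeq_succ, if_congr hp rfl rfl, h1]
    rcases hj.eq_or_lt with rfl | hlt
    · exact Or.inl h
    · have := hinj (Set.mem_Iic.2 hlt) (Set.mem_Iic.2 le_rfl) h2
      rw [← this, Nat.even_add_one] at hp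
      tauto
  · obtain _ | j := j
    · simp only [Even.zero, true_iff] at hp
      rw [if_neg hp] at h1
      exact Or.inr ⟨hp, h, h1⟩
    · have hp' : Even k ↔ Even j := by rw [Nat.even_add_one] at hp; tauto
      rw [if_congr hp' rfl rfl, apply_altSeq_succ hσ hτ] at h1
      have := hinj (Set.mem_Iic.2 (by omega)) (Set.mem_Iic.2 le_rfl) h1
      omega

theorem altSeq_reachable (hσ : ∀ x, σ (σ x) = x) (hτ : ∀ x, τ (τ x) = x) (x : Fin n) (m : ℕ) :
    (superposition σ τ).Reachable x (altSeq σ τ x m) := by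
  induction m with
  | zero => exact SimpleGraph.Reachable.refl _
  | succ m ih =>
    refine ih.trans ?_
    rw [altSeq_succ]
    split_ifs
    · exact reachable_apply_left hσ hτ _
    · exact reachable_apply_right hσ hτ _

/-- Both involutions map an initial segment of the walk into itself when they do so at its ends. -/
theorem altSeq_closed (hσ : ∀ x, σ (σ x) = x) (hτ : ∀ x, τ (τ x) = x) {x : Fin n} {k : ℕ}
    (h0 : τ x ∈ altSeq σ τ x '' Set.Iic k) (hk : altSeq σ τ x (k + 1) ∈ altSeq σ τ x '' Set.Iic k) :
    ∀ y ∈ altSeq σ τ x '' Set.Iic k,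
      σ y ∈ altSeq σ τ x '' Set.Iic k ∧ τ y ∈ altSeq σ τ x '' Set.Iic k := by
  rintro _ ⟨m, hm, rfl⟩
  have hup : (if Even m then σ else τ) (altSeq σ τ x m) ∈ altSeq σ τ x '' Set.Iic k := by
    rw [← altSeq_succ]
    rcases (Set.mem_Iic.1 hm).eq_or_lt with rfl | h
    · exact hk
    · exact ⟨m + 1, h, rfl⟩
  have hdown : (if Even m then τ else σ) (altSeq σ τ x m) ∈ altSeq σ τ x '' Set.Iic k := by
    obtain _ | m := m
    · simpa [altSeq_zero] using h0
    · refine ⟨m, Set.mem_Iic.2 (Nat.le_of_succ_le hm), ?_⟩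
      rw [← apply_altSeq_succ hσ hτ]
      by_cases h : Even m <;> simp [h, Nat.even_add_one]
  by_cases h : Even m
  · simp only [h, if_true] at hup hdown
    exact ⟨hup, hdown⟩
  · simp only [h, if_false] at hup hdown
    exact ⟨hdown, hup⟩

theorem altSeq_image_eq_supp (hσ : ∀ x, σ (σ x) = x) (hτ : ∀ x, τ (τ x) = x) {x : Fin n} {k : ℕ}
    (h0 : τ x ∈ altSeq σ τ x '' Set.Iic k) (hk : altSeq σ τ x (k + 1) ∈ altSeq σ τ x '' Set.Iic k) :
    altSeq σ τ x '' Set.Iic k = {y | (superposition σ τ).Reachable x y} := by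
  have hc := altSeq_closed hσ hτ h0 hk
  apply Set.Subset.antisymm
  · rintro _ ⟨m, -, rfl⟩
    exact altSeq_reachable hσ hτ x m
  · intro y hy
    exact mem_of_reachable hσ hτ (fun z hz => (hc z hz).1) (fun z hz => (hc z hz).2) hy
      ⟨0, Set.mem_Iic.2 (Nat.zero_le _), rfl⟩

theorem edgeMult_altSeq_zero (x y : Fin n) :
    edgeMult σ τ x y =
      (if x ≠ y ∧ altSeq σ τ x 1 = y then 1 else 0) + (if x ≠ y ∧ τ x = y then 1 else 0) := by
  simp [edgeMult, altSeq]

/-- The colours alternate along the walk: at an inner position one involution leads forward and the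
other back, whatever the parity. -/
theorem edgeMult_altSeq_succ (hσ : ∀ x, σ (σ x) = x) (hτ : ∀ x, τ (τ x) = x) (x y : Fin n)
    (m : ℕ) :
    edgeMult σ τ (altSeq σ τ x (m + 1)) y =
      (if altSeq σ τ x (m + 1) ≠ y ∧ altSeq σ τ x (m + 2) = y then 1 else 0) +
      (if altSeq σ τ x (m + 1) ≠ y ∧ altSeq σ τ x m = y then 1 else 0) := by
  rw [← apply_altSeq_succ hσ hτ x m, altSeq_succ x (m + 1)]
  by_cases h : Even m
  · simp only [edgeMult, h, Nat.even_add_one, not_true, if_true, if_false]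
    rw [add_comm]
  · simp only [edgeMult, h, Nat.even_add_one, not_false_eq_true, if_true, if_false]

theorem exists_path_listing (hσ : ∀ x, σ (σ x) = x) (hτ : ∀ x, τ (τ x) = x) {x : Fin n}
    (hx : τ x = x) :
    ∃ (k : ℕ) (v : Fin k → Fin n), Function.Injective v ∧
      Set.range v = {y | (superposition σ τ).Reachable x y} ∧
      ∀ i j : Fin k, edgeMult σ τ (v i) (v j) =
        if i.val + 1 = j.val ∨ j.val + 1 = i.val then 1 else 0 := by
  obtain ⟨k, hinj, j, hj, hkj⟩ := exists_first_return (σ := σ) (τ := τ) x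
  -- Closing up would give x_k = `τ x` = x, hence k = 0, while closing up needs k odd.
  have hk : altSeq σ τ x (k + 1) = altSeq σ τ x k := by
    rcases first_return hσ hτ hinj hj hkj with h | ⟨h1, -, h3⟩
    · exact h
    · have := hinj (Set.mem_Iic.2 (Nat.zero_le _)) (Set.mem_Iic.2 le_rfl)
        (show altSeq σ τ x 0 = altSeq σ τ x k by rw [← h3, hx, altSeq_zero])
      exact absurd (this ▸ Even.zero) h1
  have hiff : ∀ a b, a ≤ k → b ≤ k → (altSeq σ τ x a = altSeq σ τ x b ↔ a = b) :=
    fun a b ha hb => hinj.eq_iff (Set.mem_Iic.2 ha) (Set.mem_Iic.2 hb)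
  refine ⟨k + 1, fun i => altSeq σ τ x i, ?_, ?_, ?_⟩
  · intro a b hab
    exact Fin.ext ((hiff a b (by omega) (by omega)).1 hab)
  · rw [← altSeq_image_eq_supp hσ hτ ⟨0, Set.mem_Iic.2 (Nat.zero_le _), by rw [hx, altSeq_zero]⟩
      ⟨k, Set.mem_Iic.2 le_rfl, hk.symm⟩]
    ext y
    constructor
    · rintro ⟨i, rfl⟩
      exact ⟨i, Set.mem_Iic.2 (by omega), rfl⟩
    · rintro ⟨m, hm, rfl⟩
      exact ⟨⟨m, Nat.lt_succ_of_le hm⟩, rfl⟩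
  · rintro ⟨a, ha⟩ ⟨b, hb⟩
    have hup : ∀ a ≤ k, (altSeq σ τ x a ≠ altSeq σ τ x b ∧
        altSeq σ τ x (a + 1) = altSeq σ τ x b) ↔ a + 1 = b := by
      intro a ha
      rcases ha.eq_or_lt with rfl | h
      · rw [hk]
        exact ⟨fun h => absurd h.2 h.1, fun h => by omega⟩
      · rw [hiff _ _ h (by omega), Ne, hiff _ _ ha (by omega)]
        omega
    have hdown : ∀ a < k, (altSeq σ τ x (a + 1) ≠ altSeq σ τ x b ∧
        altSeq σ τ x a = altSeq σ τ x b) ↔ b = a := by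
      intro a ha
      rw [hiff _ _ ha.le (by omega), Ne, hiff _ _ ha (by omega)]
      omega
    obtain _ | a := a
    · have h1 := hup 0 (Nat.zero_le _)
      rw [altSeq_zero] at h1
      change edgeMult σ τ x (altSeq σ τ x b) = if 0 + 1 = b ∨ b + 1 = 0 then 1 else 0
      have h2 : ¬ (x ≠ altSeq σ τ x b ∧ τ x = altSeq σ τ x b) := by
        rw [hx]; exact fun h => h.1 h.2
      rw [edgeMult_altSeq_zero, if_congr h1 rfl rfl, if_neg h2, add_zero,
        if_congr (show 0 + 1 = b ∨ b + 1 = 0 ↔ 0 + 1 = b by omega) rfl rfl]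
    · change edgeMult σ τ (altSeq σ τ x (a + 1)) (altSeq σ τ x b) =
        if a + 1 + 1 = b ∨ b + 1 = a + 1 then 1 else 0
      rw [edgeMult_altSeq_succ hσ hτ, if_congr (hup (a + 1) (by omega)) rfl rfl,
        if_congr (hdown a (by omega)) rfl rfl]
      split_ifs <;> omega

/-- The walk from a vertex whose component contains no fixed point closes up, and lists the
component once. -/
theorem exists_first_closing (hσ : ∀ x, σ (σ x) = x) (hτ : ∀ x, τ (τ x) = x) {x : Fin n}
    (hx : ∀ y, (superposition σ τ).Reachable x y → σ y ≠ y ∧ τ y ≠ y) :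
    ∃ k, ¬ Even k ∧ Set.InjOn (altSeq σ τ x) (Set.Iic k) ∧ altSeq σ τ x (k + 1) = x ∧
      τ x = altSeq σ τ x k ∧
      altSeq σ τ x '' Set.Iic k = {y | (superposition σ τ).Reachable x y} := by
  obtain ⟨k, hinj, j, hj, hkj⟩ := exists_first_return (σ := σ) (τ := τ) x
  rcases first_return hσ hτ hinj hj hkj with h | ⟨h1, h2, h3⟩
  · rw [altSeq_succ] at h
    have := hx _ (altSeq_reachable hσ hτ x k)
    split_ifs at h
    · exact absurd h this.1
    · exact absurd h this.2
  · exact ⟨k, h1, hinj, h2, h3, altSeq_image_eq_supp hσ hτ ⟨k, Set.mem_Iic.2 le_rfl, h3.symm⟩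
      ⟨0, Set.mem_Iic.2 (Nat.zero_le _), h2.symm⟩⟩

theorem exists_cycle_listing (hσ : ∀ x, σ (σ x) = x) (hτ : ∀ x, τ (τ x) = x) {x : Fin n}
    (hx : ∀ y, (superposition σ τ).Reachable x y → σ y ≠ y ∧ τ y ≠ y) :
    ∃ (k : ℕ) (v : Fin k → Fin n), 2 ≤ k ∧ Function.Injective v ∧
      Set.range v = {y | (superposition σ τ).Reachable x y} ∧
      ∀ i j : Fin k, edgeMult σ τ (v i) (v j) =
        (if finRotate k i = j then 1 else 0) + (if finRotate k j = i then 1 else 0) := by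
  obtain ⟨k, hodd, hinj, hk, h0, himg⟩ := exists_first_closing hσ hτ hx
  have hk0 : k ≠ 0 := by rintro rfl; exact hodd Even.zero
  have hiff : ∀ a b, a ≤ k → b ≤ k → (altSeq σ τ x a = altSeq σ τ x b ↔ a = b) :=
    fun a b ha hb => hinj.eq_iff (Set.mem_Iic.2 ha) (Set.mem_Iic.2 hb)
  refine ⟨k + 1, fun i => altSeq σ τ x i, by omega, ?_, ?_, ?_⟩
  · intro a b hab
    exact Fin.ext ((hiff a b (by omega) (by omega)).1 hab)
  · rw [← himg]
    ext y
    constructor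
    · rintro ⟨i, rfl⟩
      exact ⟨i, Set.mem_Iic.2 (by omega), rfl⟩
    · rintro ⟨m, hm, rfl⟩
      exact ⟨⟨m, Nat.lt_succ_of_le hm⟩, rfl⟩
  · have hrot : ∀ i j : Fin (k + 1), finRotate (k + 1) i = j ↔
        (i.val < k ∧ i.val + 1 = j.val) ∨ (i.val = k ∧ j.val = 0) := by
      intro i j
      rw [Fin.ext_iff, coe_finRotate]
      have := i.isLt
      have := j.isLt
      split_ifs with h
      · subst h
        rw [Fin.val_last]
        omega
      · have : i.val ≠ k := fun h' => h (Fin.ext h')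
        omega
    rintro ⟨a, ha⟩ ⟨b, hb⟩
    have hup : ∀ a ≤ k, (altSeq σ τ x a ≠ altSeq σ τ x b ∧
        altSeq σ τ x (a + 1) = altSeq σ τ x b) ↔ (a < k ∧ a + 1 = b) ∨ (a = k ∧ b = 0) := by
      intro a ha
      rw [Ne, hiff _ _ ha (by omega)]
      rcases ha.eq_or_lt with rfl | h
      · rw [hk, ← altSeq_zero (σ := σ) (τ := τ) x, altSeq_zero (σ := σ) (τ := τ) x,
          show (x = altSeq σ τ x b ↔ 0 = b) from hiff 0 b (by omega) (by omega)]
        omega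
      · rw [hiff _ _ h (by omega)]
        omega
    have hdown : ∀ a < k, (altSeq σ τ x (a + 1) ≠ altSeq σ τ x b ∧
        altSeq σ τ x a = altSeq σ τ x b) ↔ (b < k ∧ b + 1 = a + 1) ∨ (b = k ∧ a + 1 = 0) := by
      intro a ha
      rw [hiff _ _ ha.le (by omega), Ne, hiff _ _ ha (by omega)]
      omega
    simp only [hrot]
    obtain _ | a := a
    · have h1 := hup 0 (Nat.zero_le _)
      have h2 : (x ≠ altSeq σ τ x b ∧ altSeq σ τ x k = altSeq σ τ x b) ↔
          (b < k ∧ b + 1 = 0) ∨ (b = k ∧ 0 = 0) := by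
        rw [hiff _ _ le_rfl (by omega),
          show (x ≠ altSeq σ τ x b ↔ ¬ 0 = b) from (hiff 0 b (by omega) (by omega)).not]
        omega
      rw [altSeq_zero] at h1 ⊢
      rw [edgeMult_altSeq_zero, h0, if_congr h1 rfl rfl, if_congr h2 rfl rfl]
    · rw [edgeMult_altSeq_succ hσ hτ, if_congr (hup (a + 1) (by omega)) rfl rfl,
        if_congr (hdown a (by omega)) rfl rfl]

theorem superposition_comm (σ τ : Equiv.Perm (Fin n)) : superposition σ τ = superposition τ σ := by
  simp only [superposition, edgeMult_comm_perm σ τ]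

theorem supp_eq_reachable {C : (superposition σ τ).ConnectedComponent} {x : Fin n}
    (hx : x ∈ C.supp) : C.supp = {y | (superposition σ τ).Reachable x y} := by
  ext y
  rw [SimpleGraph.ConnectedComponent.mem_supp_iff] at hx ⊢
  rw [← hx, SimpleGraph.ConnectedComponent.eq]
  exact ⟨fun h => h.symm, fun h => h.symm⟩

theorem isPathComponent_of_componentFix_ne_zero (hσ : ∀ x, σ (σ x) = x) (hτ : ∀ x, τ (τ x) = x)
    {C : (superposition σ τ).ConnectedComponent} (h : componentFix C ≠ 0) :
    IsPathComponent σ τ C := by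
  rw [Ne, componentFix_eq_zero_iff] at h
  push Not at h
  obtain ⟨x, hx, h⟩ := h
  rw [IsPathComponent, supp_eq_reachable hx]
  by_cases h' : σ x = x
  -- The walk must start at a fixed point of its second involution, so `σ` and `τ` exchange roles
  -- here.
  · obtain ⟨k, v, h1, h2, h3⟩ := exists_path_listing hτ hσ h'
    exact ⟨k, v, h1, by rw [h2, superposition_comm], fun i j => by
      rw [edgeMult_comm_perm]; exact h3 i j⟩
  · exact exists_path_listing hσ hτ (h h')

theorem isCycleComponent_of_componentFix_eq_zero (hσ : ∀ x, σ (σ x) = x)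
    (hτ : ∀ x, τ (τ x) = x) {C : (superposition σ τ).ConnectedComponent}
    (h : componentFix C = 0) : IsCycleComponent σ τ C := by
  rw [componentFix_eq_zero_iff] at h
  obtain ⟨x, hx⟩ := C.nonempty_supp
  rw [supp_eq_reachable hx] at h
  rw [IsCycleComponent, supp_eq_reachable hx]
  exact exists_cycle_listing hσ hτ h

theorem isCycleComponent_iff (hσ : ∀ x, σ (σ x) = x) (hτ : ∀ x, τ (τ x) = x)
    {C : (superposition σ τ).ConnectedComponent} :
    IsCycleComponent σ τ C ↔ componentFix C = 0 :=
  ⟨fun h => h.componentFix_eq hσ hτ, isCycleComponent_of_componentFix_eq_zero hσ hτ⟩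

theorem isPathComponent_iff (hσ : ∀ x, σ (σ x) = x) (hτ : ∀ x, τ (τ x) = x)
    {C : (superposition σ τ).ConnectedComponent} :
    IsPathComponent σ τ C ↔ componentFix C ≠ 0 :=
  ⟨fun h => by rw [h.componentFix_eq hσ hτ]; decide,
    isPathComponent_of_componentFix_ne_zero hσ hτ⟩

theorem sum_componentFix (σ τ : Equiv.Perm (Fin n)) [Fintype (superposition σ τ).ConnectedComponent] :
    ∑ C : (superposition σ τ).ConnectedComponent, componentFix C = ∑ x, fixMult σ τ x := by
  classical
  simp only [componentFix]
  exact Finset.sum_fiberwise _ _ _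

theorem two_mul_numPaths (hσ : ∀ x, σ (σ x) = x) (hτ : ∀ x, τ (τ x) = x) :
    2 * numPaths σ τ = ∑ x, fixMult σ τ x := by
  classical
  have := Fintype.ofFinite (superposition σ τ).ConnectedComponent
  rw [← sum_componentFix, numPaths, Nat.card_eq_fintype_card, Fintype.card_subtype,
    Finset.card_filter, Finset.mul_sum]
  refine Finset.sum_congr rfl fun C _ => ?_
  split_ifs with h
  · rw [h.componentFix_eq hσ hτ, mul_one]
  · rw [isPathComponent_iff hσ hτ, not_not] at h
    rw [h, mul_zero]

end Components

/-! ### Cycles of the product of the two involutions -/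

section PermCycles

variable {n : ℕ} {σ τ : Equiv.Perm (Fin n)}

/-- Dihedral relation: `σ` conjugates `τ * σ` to its inverse. -/
theorem zpow_mul_apply_apply_left (hσ : ∀ x, σ (σ x) = x) (hτ : ∀ x, τ (τ x) = x) (i : ℤ)
    (x : Fin n) : σ (((τ * σ) ^ i) x) = ((τ * σ) ^ (-i)) (σ x) := by
  have hs : σ⁻¹ = σ := inv_eq_of_mul_eq_one_left (Equiv.ext hσ)
  have ht : τ⁻¹ = τ := inv_eq_of_mul_eq_one_left (Equiv.ext hτ)
  have hc : σ * (τ * σ) * σ⁻¹ = (τ * σ)⁻¹ := by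
    rw [mul_inv_rev, hs, ht, mul_assoc, mul_assoc, show σ * σ = 1 from Equiv.ext hσ, mul_one]
  have : σ * (τ * σ) ^ i = (τ * σ) ^ (-i) * σ := by
    rw [zpow_neg, ← inv_zpow, ← hc, conj_zpow]
    group
  exact DFunLike.congr_fun this x

theorem SameCycle.apply_left (hσ : ∀ x, σ (σ x) = x) (hτ : ∀ x, τ (τ x) = x) {x y : Fin n}
    (h : (τ * σ).SameCycle x y) : (τ * σ).SameCycle (σ x) (σ y) := by
  obtain ⟨i, rfl⟩ := h
  exact ⟨-i, (zpow_mul_apply_apply_left hσ hτ i x).symm⟩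

theorem sameCycle_apply_left_apply_right (hσ : ∀ x, σ (σ x) = x) (x : Fin n) :
    (τ * σ).SameCycle (σ x) (τ x) :=
  ⟨1, by simp [hσ]⟩

theorem reachable_zpow (hσ : ∀ x, σ (σ x) = x) (hτ : ∀ x, τ (τ x) = x) (i : ℤ) (x : Fin n) :
    (superposition σ τ).Reachable x (((τ * σ) ^ i) x) := by
  have h1 : ∀ y, (superposition σ τ).Reachable y ((τ * σ) y) := fun y =>
    (reachable_apply_left hσ hτ y).trans (reachable_apply_right hσ hτ _)
  induction i with
  | zero => exact SimpleGraph.Reachable.refl _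
  | succ i ih =>
    rw [add_comm, zpow_one_add]
    exact ih.trans (h1 _)
  | pred i ih =>
    refine ih.trans ?_
    have := h1 (((τ * σ) ^ (-(i : ℤ) - 1)) x)
    rw [← Equiv.Perm.mul_apply, ← zpow_one_add, show 1 + (-(i : ℤ) - 1) = -i by ring] at this
    exact this.symm

theorem SameCycle.reachable (hσ : ∀ x, σ (σ x) = x) (hτ : ∀ x, τ (τ x) = x) {x y : Fin n}
    (h : (τ * σ).SameCycle x y) : (superposition σ τ).Reachable x y := by
  obtain ⟨i, rfl⟩ := h
  exact reachable_zpow hσ hτ i x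

/-- In the dihedral group generated by `σ` and `τ` the rotations have index at most 2, so an orbit
is the union of the rotation orbits of `x` and `σ x`. -/
theorem reachable_iff_sameCycle (hσ : ∀ x, σ (σ x) = x) (hτ : ∀ x, τ (τ x) = x) {x y : Fin n} :
    (superposition σ τ).Reachable x y ↔
      (τ * σ).SameCycle x y ∨ (τ * σ).SameCycle (σ x) y := by
  constructor
  · intro h
    have hS : ∀ y ∈ {y | (τ * σ).SameCycle x y ∨ (τ * σ).SameCycle (σ x) y},
        σ y ∈ {y | (τ * σ).SameCycle x y ∨ (τ * σ).SameCycle (σ x) y} := by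
      rintro y (h | h)
      · exact Or.inr (SameCycle.apply_left hσ hτ h)
      · have := SameCycle.apply_left hσ hτ h
        rw [hσ] at this
        exact Or.inl this
    refine mem_of_reachable hσ hτ hS (fun y hy => ?_) h (Or.inl (Equiv.Perm.SameCycle.refl _ _))
    have := sameCycle_apply_left_apply_right (τ := τ) hσ y
    exact (hS y hy).imp (fun h => h.trans this) (fun h => h.trans this)
  · rintro (h | h)
    · exact SameCycle.reachable hσ hτ h
    · exact (reachable_apply_left hσ hτ x).trans (SameCycle.reachable hσ hτ h)

theorem sameCycle_apply_left_iff (hσ : ∀ x, σ (σ x) = x) (hτ : ∀ x, τ (τ x) = x) (x : Fin n) :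
    (τ * σ).SameCycle x (σ x) ↔
      ∃ y, (superposition σ τ).Reachable x y ∧ (σ y = y ∨ τ y = y) := by
  constructor
  · rintro ⟨i, hi⟩
    -- The fixed point lies halfway between `x` and `σ x`; the parity of the exponent decides which
    -- involution fixes it.
    rcases Int.even_or_odd' i with ⟨j, rfl | rfl⟩
    · refine ⟨((τ * σ) ^ j) x, reachable_zpow hσ hτ j x, Or.inl ?_⟩
      rw [zpow_mul_apply_apply_left hσ hτ, ← hi, ← Equiv.Perm.mul_apply, ← zpow_add]
      congr 2
      ring
    · refine ⟨((τ * σ) ^ (j + 1)) x, reachable_zpow hσ hτ _ x, Or.inr ?_⟩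
      have h1 : τ (((τ * σ) ^ (j + 1)) x) = σ (((τ * σ) ^ j) x) := by
        rw [add_comm, zpow_one_add, Equiv.Perm.mul_apply, Equiv.Perm.mul_apply, hτ]
      rw [h1, zpow_mul_apply_apply_left hσ hτ, ← hi, ← Equiv.Perm.mul_apply, ← zpow_add]
      congr 2
      ring
  · rintro ⟨y, hxy, hy⟩
    have hyy : (τ * σ).SameCycle y (σ y) := by
      rcases hy with h | h
      · rw [h]
      · have := sameCycle_apply_left_apply_right (τ := τ) hσ y
        rw [h] at this
        exact this.symm
    rcases (reachable_iff_sameCycle hσ hτ).1 hxy with h | h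
    · exact (h.trans hyy).trans (SameCycle.apply_left hσ hτ h).symm
    · have h' := SameCycle.apply_left hσ hτ h
      rw [hσ] at h'
      exact (h'.trans hyy.symm).trans h.symm

/-- Send each cycle of `τ * σ` to its component. The fibre over the component of `x` consists of the
classes of `x` and `σ x`, which coincide exactly when the component has a fixed point. -/
theorem numPermCycles_mul (hσ : ∀ x, σ (σ x) = x) (hτ : ∀ x, τ (τ x) = x) :
    numPermCycles (τ * σ) = numPaths σ τ + 2 * numCycles σ τ := by
  classical
  have := Fintype.ofFinite (superposition σ τ).ConnectedComponent
  have := Fintype.ofFinite (Quotient (Equiv.Perm.SameCycle.setoid (τ * σ)))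
  let f : Quotient (Equiv.Perm.SameCycle.setoid (τ * σ)) →
      (superposition σ τ).ConnectedComponent :=
    Quotient.lift (superposition σ τ).connectedComponentMk fun x y h =>
      SimpleGraph.ConnectedComponent.sound (SameCycle.reachable hσ hτ h)
  have hfib : ∀ x : Fin n, Finset.univ.filter (fun q => f q = (superposition σ τ).connectedComponentMk x)
      = {(Quotient.mk (Equiv.Perm.SameCycle.setoid (τ * σ)) x),
        (Quotient.mk (Equiv.Perm.SameCycle.setoid (τ * σ)) (σ x))} := by
    intro x
    ext q
    induction q using Quotient.inductionOn with
    | h y =>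
      have h1 : f (Quotient.mk (Equiv.Perm.SameCycle.setoid (τ * σ)) y) =
          (superposition σ τ).connectedComponentMk x ↔ (superposition σ τ).Reachable x y :=
        SimpleGraph.ConnectedComponent.eq.trans ⟨fun h => h.symm, fun h => h.symm⟩
      rw [Finset.mem_filter, h1, reachable_iff_sameCycle hσ hτ, Finset.mem_insert,
        Finset.mem_singleton, Quotient.eq, Quotient.eq]
      exact ⟨fun h => h.2.imp (fun h => h.symm) (fun h => h.symm),
        fun h => ⟨Finset.mem_univ _, h.imp (fun h => h.symm) (fun h => h.symm)⟩⟩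
  rw [numPermCycles, numPaths, numCycles, Nat.card_eq_fintype_card, Nat.card_eq_fintype_card,
    Nat.card_eq_fintype_card, Fintype.card_subtype, Fintype.card_subtype, Finset.card_filter,
    Finset.card_filter, Finset.mul_sum, ← Finset.sum_add_distrib, ← Finset.card_univ,
    Finset.card_eq_sum_card_fiberwise (f := f) (t := Finset.univ) fun _ _ => Finset.mem_univ _]
  refine Finset.sum_congr rfl fun C _ => ?_
  rw [isPathComponent_iff hσ hτ, isCycleComponent_iff hσ hτ]
  induction C using SimpleGraph.ConnectedComponent.ind with | h x => ?_
  rw [hfib x]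
  have hx : x ∈ ((superposition σ τ).connectedComponentMk x).supp := rfl
  have key : (τ * σ).SameCycle x (σ x) ↔
      componentFix ((superposition σ τ).connectedComponentMk x) ≠ 0 := by
    rw [sameCycle_apply_left_iff hσ hτ, Ne, componentFix_eq_zero_iff, supp_eq_reachable hx]
    simp only [Set.mem_ofPred_eq, not_forall, not_and_or, not_not, exists_prop]
  by_cases h : componentFix ((superposition σ τ).connectedComponentMk x) = 0
  · rw [Finset.card_pair]
    · simp [h]
    · intro h'
      exact key.1 (Quotient.eq.1 h') h
  · rw [show Quotient.mk (Equiv.Perm.SameCycle.setoid (τ * σ)) x =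
      Quotient.mk (Equiv.Perm.SameCycle.setoid (τ * σ)) (σ x) from Quotient.sound (key.2 h)]
    simp [h]

end PermCycles

/-! ### Counting involutions and the exact means -/

section Counting

/-- The number of involutions of an `n`-element set. -/
def involutionCount (n : ℕ) : ℕ := (involutions n).card

theorem mem_involutions {n : ℕ} {σ : Equiv.Perm (Fin n)} :
    σ ∈ involutions n ↔ ∀ x, σ (σ x) = x := by
  simp [involutions]

/-- The involutions extending a given involution of a subset are counted by the involutions of the
complement. -/
theorem card_involutions_extending {n : ℕ} {α : Type*} [Fintype α] (w : α ↪ Fin n)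
    (θ : Equiv.Perm α) (hθ : ∀ a, θ (θ a) = a)
    [DecidablePred fun σ : Equiv.Perm (Fin n) => ∀ a, σ (w a) = w (θ a)] :
    ((involutions n).filter (fun σ => ∀ a, σ (w a) = w (θ a))).card =
      involutionCount (n - Fintype.card α) := by
  classical
  have hcard : Fintype.card {x // ¬ x ∈ Set.range w} = n - Fintype.card α := by
    rw [Fintype.card_subtype_compl, Fintype.card_fin]
    congr 1
    exact (Fintype.card_congr (Equiv.ofInjective w w.injective)).symm
  let e : {x // ¬ x ∈ Set.range w} ≃ Fin (n - Fintype.card α) := Fintype.equivFinOfCardEq hcard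
  let θ' : Equiv.Perm {x // x ∈ Set.range w} := (Equiv.ofInjective w w.injective).permCongr θ
  have hθ' : ∀ a, (θ' ⟨w a, a, rfl⟩ : Fin n) = w (θ a) := by
    intro a
    simp only [θ', Equiv.permCongr_apply]
    rw [show (⟨w a, a, rfl⟩ : {x // x ∈ Set.range w}) = Equiv.ofInjective w w.injective a from rfl,
      Equiv.symm_apply_apply]
    rfl
  symm
  -- Glue the prescribed involution on the range of `w` to an arbitrary one on the complement.
  refine Finset.card_bij
    (fun ρ _ => Equiv.Perm.subtypeCongr θ' (e.symm.permCongr ρ)) ?_ ?_ ?_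
  · intro ρ hρ
    rw [mem_involutions] at hρ
    have hw : ∀ a, Equiv.Perm.subtypeCongr θ' (e.symm.permCongr ρ) (w a) = w (θ a) := by
      intro a
      rw [Equiv.Perm.subtypeCongr.left_apply _ _ (Set.mem_range_self a), hθ']
    refine Finset.mem_filter.2 ⟨mem_involutions.2 fun x => ?_, hw⟩
    by_cases hx : x ∈ Set.range w
    · obtain ⟨a, rfl⟩ := hx
      rw [hw, hw, hθ]
    · rw [Equiv.Perm.subtypeCongr.right_apply _ _ hx,
        Equiv.Perm.subtypeCongr.right_apply_subtype]
      simp [Equiv.permCongr_apply, hρ]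
  · intro ρ _ ρ' _ h
    apply e.symm.permCongr.injective
    ext x
    have := DFunLike.congr_fun h (x : Fin n)
    simp only [Equiv.Perm.subtypeCongr.right_apply_subtype] at this
    exact congrArg Fin.val this
  · intro σ hσ
    obtain ⟨hσ, hw⟩ := Finset.mem_filter.1 hσ
    rw [mem_involutions] at hσ
    have hp : ∀ x, ¬ σ x ∈ Set.range w ↔ ¬ x ∈ Set.range w := by
      have h1 : ∀ x, x ∈ Set.range w → σ x ∈ Set.range w := by
        rintro _ ⟨a, rfl⟩
        exact ⟨θ a, (hw a).symm⟩
      intro x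
      exact not_congr ⟨fun h => hσ x ▸ h1 _ h, h1 x⟩
    refine ⟨e.permCongr (σ.subtypePerm hp), mem_involutions.2 fun x => ?_, ?_⟩
    · simp [Equiv.permCongr_apply, hσ]
    · ext x
      congr 1
      by_cases hx : x ∈ Set.range w
      · obtain ⟨a, rfl⟩ := hx
        rw [Equiv.Perm.subtypeCongr.left_apply _ _ (Set.mem_range_self a), hθ', hw]
      · rw [Equiv.Perm.subtypeCongr.right_apply _ _ hx]
        simp [Equiv.permCongr_apply]

theorem card_involutions_fixing {n : ℕ} (x : Fin n) :
    ((involutions n).filter (fun σ => σ x = x)).card = involutionCount (n - 1) := by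
  have := card_involutions_extending (α := Unit) ⟨fun _ => x, fun _ _ _ => rfl⟩ 1 (fun _ => rfl)
  rw [Fintype.card_unit] at this
  rw [← this]
  congr 1
  ext σ
  rw [Finset.mem_filter, Finset.mem_filter]
  exact and_congr_right fun _ => ⟨fun h _ => h, fun h => h ()⟩

theorem card_involutions_matching {n : ℕ} {x y : Fin n} (h : x ≠ y) :
    ((involutions n).filter (fun σ => σ x = y)).card = involutionCount (n - 2) := by
  have := card_involutions_extending (α := Bool)
    ⟨fun b => if b then x else y, fun a b hab => by
      cases a <;> cases b <;> simp [h, h.symm] at hab ⊢⟩ (Equiv.swap true false)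
    (fun _ => Equiv.swap_apply_self _ _ _)
  rw [Fintype.card_bool] at this
  rw [← this]
  congr 1
  ext σ
  rw [Finset.mem_filter, Finset.mem_filter]
  refine and_congr_right fun hσ => ?_
  rw [mem_involutions] at hσ
  constructor
  · intro hxy b
    cases b
    · change σ y = x
      rw [← hxy, hσ]
    · exact hxy
  · intro hb
    exact hb true

theorem involutionCount_zero : involutionCount 0 = 1 := by
  decide

theorem involutionCount_one : involutionCount 1 = 1 := by
  decide

/-- Classify by the image of 0: itself, or one of n + 1 partners. -/
theorem involutionCount_add_two (n : ℕ) :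
    involutionCount (n + 2) = involutionCount (n + 1) + (n + 1) * involutionCount n := by
  rw [involutionCount, Finset.card_eq_sum_card_fiberwise (f := fun σ => σ 0) (t := Finset.univ)
    fun _ _ => Finset.mem_coe.2 (Finset.mem_univ _), Fin.sum_univ_succ, card_involutions_fixing,
    Finset.sum_congr rfl fun i _ => card_involutions_matching (Fin.succ_ne_zero i).symm]
  simp

theorem involutionCount_pos (n : ℕ) : 0 < involutionCount n :=
  Finset.card_pos.2 ⟨1, mem_involutions.2 fun _ => rfl⟩

theorem sum_numPaths (n : ℕ) :
    ∑ σ ∈ involutions n, ∑ τ ∈ involutions n, numPaths σ τ =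
      n * involutionCount (n - 1) * involutionCount n := by
  have h2 : 2 * ∑ σ ∈ involutions n, ∑ τ ∈ involutions n, numPaths σ τ =
      2 * (n * involutionCount (n - 1) * involutionCount n) := by
    have h1 : ∑ σ ∈ involutions n, ∑ x, (if σ x = x then 1 else 0) =
        n * involutionCount (n - 1) := by
      rw [Finset.sum_comm]
      simp only [← Finset.card_filter, card_involutions_fixing]
      simp
    simp only [Finset.mul_sum]
    calc ∑ σ ∈ involutions n, ∑ τ ∈ involutions n, 2 * numPaths σ τ
        = ∑ σ ∈ involutions n, ∑ τ ∈ involutions n,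
            (∑ x, (if σ x = x then 1 else 0) + ∑ x, (if τ x = x then 1 else 0)) := by
          refine Finset.sum_congr rfl fun σ hσ => Finset.sum_congr rfl fun τ hτ => ?_
          rw [two_mul_numPaths (mem_involutions.1 hσ) (mem_involutions.1 hτ),
            ← Finset.sum_add_distrib]
          rfl
      _ = _ := by
          simp only [Finset.sum_add_distrib, Finset.sum_const, smul_eq_mul, h1, ← Finset.mul_sum]
          simp only [involutionCount]
          ring
  omega

variable {n : ℕ} {σ τ : Equiv.Perm (Fin n)}

/-! ### Listings of alternating cycles -/

/-- `w` lists an alternating cycle with `2 k` vertices, starting with a solid edge. -/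
def IsAltCycle (σ τ : Equiv.Perm (Fin n)) {k : ℕ} (w : Fin k ⊕ Fin k ↪ Fin n) : Prop :=
  (∀ i, σ (w (Sum.inl i)) = w (Sum.inr i)) ∧
    ∀ i, τ (w (Sum.inr i)) = w (Sum.inl (finRotate k i))

theorem IsAltCycle.apply_left_inr (hσ : ∀ x, σ (σ x) = x) {k : ℕ} {w : Fin k ⊕ Fin k ↪ Fin n}
    (hw : IsAltCycle σ τ w) (i : Fin k) : σ (w (Sum.inr i)) = w (Sum.inl i) := by
  rw [← hw.1, hσ]

theorem IsAltCycle.apply_right_inl (hτ : ∀ x, τ (τ x) = x) {k : ℕ} {w : Fin k ⊕ Fin k ↪ Fin n}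
    (hw : IsAltCycle σ τ w) (i : Fin k) :
    τ (w (Sum.inl i)) = w (Sum.inr ((finRotate k).symm i)) := by
  obtain ⟨j, rfl⟩ := (finRotate k).surjective i
  rw [← hw.2, hτ, Equiv.symm_apply_apply]

theorem IsAltCycle.range_eq (hσ : ∀ x, σ (σ x) = x) (hτ : ∀ x, τ (τ x) = x) {k : ℕ}
    {w : Fin (k + 1) ⊕ Fin (k + 1) ↪ Fin n} (hw : IsAltCycle σ τ w) :
    Set.range w = {y | (superposition σ τ).Reachable (w (Sum.inl 0)) y} := by
  apply Set.Subset.antisymm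
  · have hl : ∀ i, (superposition σ τ).Reachable (w (Sum.inl 0)) (w (Sum.inl i)) := by
      intro i
      induction i using Fin.induction with
      | zero => exact SimpleGraph.Reachable.refl _
      | succ i ih =>
        have h1 := hw.2 i.castSucc
        rw [finRotate_apply, Fin.coeSucc_eq_succ] at h1
        rw [← h1, ← hw.1]
        exact (ih.trans (reachable_apply_left hσ hτ _)).trans (reachable_apply_right hσ hτ _)
    rintro _ ⟨i | i, rfl⟩
    · exact hl i
    · rw [← hw.1]
      exact (hl i).trans (reachable_apply_left hσ hτ _)
  · intro y hy
    refine mem_of_reachable hσ hτ ?_ ?_ hy ⟨_, rfl⟩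
    · rintro _ ⟨i | i, rfl⟩
      · exact ⟨_, (hw.1 i).symm⟩
      · exact ⟨_, (hw.apply_left_inr hσ i).symm⟩
    · rintro _ ⟨i | i, rfl⟩
      · exact ⟨_, (hw.apply_right_inl hτ i).symm⟩
      · exact ⟨_, (hw.2 i).symm⟩

theorem IsAltCycle.not_fixed (hσ : ∀ x, σ (σ x) = x) (hτ : ∀ x, τ (τ x) = x) {k : ℕ}
    {w : Fin k ⊕ Fin k ↪ Fin n} (hw : IsAltCycle σ τ w) :
    ∀ y ∈ Set.range w, σ y ≠ y ∧ τ y ≠ y := by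
  rintro _ ⟨i | i, rfl⟩
  · rw [hw.1, hw.apply_right_inl hτ]
    simp [w.injective.eq_iff]
  · rw [hw.2, hw.apply_left_inr hσ]
    simp [w.injective.eq_iff]

theorem IsAltCycle.ext {k : ℕ} {w w' : Fin (k + 1) ⊕ Fin (k + 1) ↪ Fin n}
    (hw : IsAltCycle σ τ w) (hw' : IsAltCycle σ τ w') (h : w (Sum.inl 0) = w' (Sum.inl 0)) :
    w = w' := by
  have hl : ∀ i, w (Sum.inl i) = w' (Sum.inl i) := by
    intro i
    induction i using Fin.induction with
    | zero => exact h
    | succ i ih =>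
      have h1 := hw.2 i.castSucc
      have h2 := hw'.2 i.castSucc
      rw [finRotate_apply, Fin.coeSucc_eq_succ] at h1 h2
      rw [← h1, ← h2, ← hw.1, ← hw'.1, ih]
  ext i
  rcases i with i | i
  · rw [hl]
  · rw [← hw.1, ← hw'.1, hl]

theorem exists_isAltCycle (hσ : ∀ x, σ (σ x) = x) (hτ : ∀ x, τ (τ x) = x) {x : Fin n}
    (hx : ∀ y, (superposition σ τ).Reachable x y → σ y ≠ y ∧ τ y ≠ y) :
    ∃ (k : ℕ) (w : Fin (k + 1) ⊕ Fin (k + 1) ↪ Fin n),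
      IsAltCycle σ τ w ∧ w (Sum.inl 0) = x := by
  obtain ⟨m, hodd, hinj, hm, -, -⟩ := exists_first_closing hσ hτ hx
  obtain ⟨k, rfl⟩ := Nat.not_even_iff_odd.1 hodd
  have hiff : ∀ a b, a ≤ 2 * k + 1 → b ≤ 2 * k + 1 →
      (altSeq σ τ x a = altSeq σ τ x b ↔ a = b) :=
    fun a b ha hb => hinj.eq_iff (Set.mem_Iic.2 ha) (Set.mem_Iic.2 hb)
  -- Even positions of the walk are followed by a solid edge, odd ones by a dotted edge; the closing
  -- index is odd, so the two classes have k + 1 members each.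
  refine ⟨k, ⟨Sum.elim (fun i => altSeq σ τ x (2 * i)) (fun i => altSeq σ τ x (2 * i + 1)), ?_⟩,
    ⟨?_, ?_⟩, rfl⟩
  · rintro (i | i) (j | j) h
    · have := (hiff _ _ (by omega) (by omega)).1 h
      exact congrArg Sum.inl (Fin.ext (by omega))
    · have := (hiff _ _ (by omega) (by omega)).1 h
      omega
    · have := (hiff _ _ (by omega) (by omega)).1 h
      omega
    · have := (hiff _ _ (by omega) (by omega)).1 h
      exact congrArg Sum.inr (Fin.ext (by omega))
  · intro i
    change σ (altSeq σ τ x (2 * i)) = altSeq σ τ x (2 * i + 1)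
    rw [altSeq_succ, if_pos (even_two_mul _)]
  · intro i
    change τ (altSeq σ τ x (2 * i + 1)) = altSeq σ τ x (2 * (finRotate (k + 1) i))
    have h1 : τ (altSeq σ τ x (2 * i + 1)) = altSeq σ τ x (2 * i + 1 + 1) := by
      rw [altSeq_succ _ (2 * i.val + 1), if_neg (by simp)]
    rw [h1, coe_finRotate]
    split_ifs with h
    · subst h
      exact hm
    · rfl

/-- The number of vertices in the component of `x`. -/
noncomputable def componentCard (σ τ : Equiv.Perm (Fin n)) (x : Fin n) : ℕ :=
  Set.ncard {y | (superposition σ τ).Reachable x y}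

theorem IsAltCycle.componentCard_eq (hσ : ∀ x, σ (σ x) = x) (hτ : ∀ x, τ (τ x) = x) {k : ℕ}
    {w : Fin (k + 1) ⊕ Fin (k + 1) ↪ Fin n} (hw : IsAltCycle σ τ w) :
    componentCard σ τ (w (Sum.inl 0)) = 2 * (k + 1) := by
  rw [componentCard, ← hw.range_eq hσ hτ, ← Set.image_univ,
    Set.ncard_image_of_injective _ w.injective, Set.ncard_univ, Nat.card_sum, Nat.card_fin]
  omega

theorem componentFix_mk_eq_zero_iff {x : Fin n} :
    componentFix ((superposition σ τ).connectedComponentMk x) = 0 ↔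
      ∀ y, (superposition σ τ).Reachable x y → σ y ≠ y ∧ τ y ≠ y := by
  rw [componentFix_eq_zero_iff, supp_eq_reachable (x := x) rfl]
  rfl

open Classical in
-- The solid first edge fixes the direction, so each vertex of a cycle starts exactly one listing.
-- For k = 0 the empty listing would break the equality.
theorem card_isAltCycle (hσ : ∀ x, σ (σ x) = x) (hτ : ∀ x, τ (τ x) = x) {k : ℕ} (hk : 0 < k) :
    (Finset.univ.filter fun w : Fin k ⊕ Fin k ↪ Fin n => IsAltCycle σ τ w).card =
      (Finset.univ.filter fun x =>
        componentFix ((superposition σ τ).connectedComponentMk x) = 0 ∧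
          componentCard σ τ x = 2 * k).card := by
  obtain ⟨k, rfl⟩ := Nat.exists_eq_succ_of_ne_zero hk.ne'
  refine Finset.card_bij (fun w _ => w (Sum.inl 0)) ?_ ?_ ?_
  · intro w hw
    have hw := (Finset.mem_filter.1 hw).2
    refine Finset.mem_filter.2 ⟨Finset.mem_univ _, componentFix_mk_eq_zero_iff.2 fun y hy => ?_,
      hw.componentCard_eq hσ hτ⟩
    refine hw.not_fixed hσ hτ y ?_
    rw [hw.range_eq hσ hτ]
    exact hy
  · intro w hw w' hw' h
    exact (Finset.mem_filter.1 hw).2.ext (Finset.mem_filter.1 hw').2 h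
  · intro x hx
    obtain ⟨-, hx, hc⟩ := Finset.mem_filter.1 hx
    obtain ⟨k', w, hw, rfl⟩ := exists_isAltCycle hσ hτ (componentFix_mk_eq_zero_iff.1 hx)
    rw [hw.componentCard_eq hσ hτ] at hc
    obtain rfl : k' = k := by omega
    exact ⟨w, Finset.mem_filter.2 ⟨Finset.mem_univ _, hw⟩, rfl⟩

open Classical in
-- Each cycle spreads weight 1 evenly over its vertices.
theorem numCycles_eq_sum_inv (hσ : ∀ x, σ (σ x) = x) (hτ : ∀ x, τ (τ x) = x) :
    (numCycles σ τ : ℝ) = ∑ x,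
      if componentFix ((superposition σ τ).connectedComponentMk x) = 0 then
        ((componentCard σ τ x : ℝ))⁻¹ else 0 := by
  have := Fintype.ofFinite (superposition σ τ).ConnectedComponent
  rw [numCycles, Nat.card_eq_fintype_card, Fintype.card_subtype, Finset.card_filter,
    ← Finset.sum_fiberwise Finset.univ (superposition σ τ).connectedComponentMk]
  push_cast
  refine Finset.sum_congr rfl fun C _ => ?_
  rw [isCycleComponent_iff hσ hτ]
  induction C using SimpleGraph.ConnectedComponent.ind with | h x => ?_
  have hc : ∀ y ∈ Finset.univ.filter fun y => (superposition σ τ).connectedComponentMk y =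
      (superposition σ τ).connectedComponentMk x,
      (if componentFix ((superposition σ τ).connectedComponentMk y) = 0 then
        ((componentCard σ τ y : ℝ))⁻¹ else 0) =
      if componentFix ((superposition σ τ).connectedComponentMk x) = 0 then
        ((componentCard σ τ x : ℝ))⁻¹ else 0 := by
    intro y hy
    have hy := (Finset.mem_filter.1 hy).2
    rw [hy, componentCard, componentCard,
      ← supp_eq_reachable (C := (superposition σ τ).connectedComponentMk x) hy,
      ← supp_eq_reachable (C := (superposition σ τ).connectedComponentMk x) rfl]
  rw [Finset.sum_congr rfl hc, Finset.sum_const, nsmul_eq_mul]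
  have hcard : (Finset.univ.filter fun y => (superposition σ τ).connectedComponentMk y =
      (superposition σ τ).connectedComponentMk x).card = componentCard σ τ x := by
    rw [componentCard, ← supp_eq_reachable (C := (superposition σ τ).connectedComponentMk x) rfl,
      ← Set.ncard_coe_finset]
    congr 1
    ext y
    simp
  have hpos : 0 < componentCard σ τ x := by
    rw [← hcard]
    exact Finset.card_pos.2 ⟨x, by simp⟩
  rw [hcard]
  split_ifs
  · rw [mul_inv_cancel₀]
    exact_mod_cast hpos.ne'
  · simp

open Classical in
theorem numCycles_eq_sum_isAltCycle (hσ : ∀ x, σ (σ x) = x) (hτ : ∀ x, τ (τ x) = x) :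
    (numCycles σ τ : ℝ) = ∑ k ∈ Finset.Icc 1 (n / 2), (2 * (k : ℝ))⁻¹ *
      (Finset.univ.filter fun w : Fin k ⊕ Fin k ↪ Fin n => IsAltCycle σ τ w).card := by
  have h1 : ∀ k ∈ Finset.Icc 1 (n / 2), (2 * (k : ℝ))⁻¹ *
      (Finset.univ.filter fun w : Fin k ⊕ Fin k ↪ Fin n => IsAltCycle σ τ w).card =
      ∑ x, if componentFix ((superposition σ τ).connectedComponentMk x) = 0 ∧
          componentCard σ τ x = 2 * k then (2 * (k : ℝ))⁻¹ else 0 := by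
    intro k hk
    rw [card_isAltCycle hσ hτ (Finset.mem_Icc.1 hk).1, ← Finset.sum_filter, Finset.sum_const,
      nsmul_eq_mul, mul_comm]
  rw [Finset.sum_congr rfl h1, Finset.sum_comm, numCycles_eq_sum_inv hσ hτ]
  refine Finset.sum_congr rfl fun x _ => ?_
  split_ifs with hx
  · obtain ⟨k, w, hw, rfl⟩ := exists_isAltCycle hσ hτ (componentFix_mk_eq_zero_iff.1 hx)
    have hle : 2 * (k + 1) ≤ n := by
      have := Fintype.card_le_of_embedding w
      simp only [Fintype.card_sum, Fintype.card_fin] at this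
      omega
    rw [hw.componentCard_eq hσ hτ, Finset.sum_eq_single_of_mem (k + 1)
      (Finset.mem_Icc.2 ⟨by omega, by omega⟩)]
    · rw [if_pos ⟨hx, rfl⟩]
      push_cast
      rfl
    · intro j _ hj
      rw [if_neg]
      rintro ⟨-, h⟩
      omega
  · rw [Finset.sum_eq_zero]
    intro k _
    exact if_neg fun h => hx h.1

theorem sum_card_isAltCycle (n k : ℕ) :
    open Classical in
    ∑ σ ∈ involutions n, ∑ τ ∈ involutions n,
      (Finset.univ.filter fun w : Fin k ⊕ Fin k ↪ Fin n => IsAltCycle σ τ w).card =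
      n.descFactorial (2 * k) * involutionCount (n - 2 * k) ^ 2 := by
  classical
  -- The involutions of the labels that an alternating listing imposes on `σ` and on `τ`. Once `w`
  -- is fixed the two conditions are independent.
  let θ₁ : Equiv.Perm (Fin k ⊕ Fin k) := Equiv.sumComm _ _
  let θ₂ : Equiv.Perm (Fin k ⊕ Fin k) :=
    (Equiv.sumComm _ _).trans (Equiv.sumCongr (finRotate k) (finRotate k).symm)
  have h₁ : ∀ a, θ₁ (θ₁ a) = a := by rintro (i | i) <;> rfl
  have h₂ : ∀ a, θ₂ (θ₂ a) = a := by rintro (i | i) <;> simp [θ₂, -finRotate_apply, -finRotate_symm_apply]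
  have hcard : Fintype.card (Fin k ⊕ Fin k) = 2 * k := by simp [two_mul]
  have hiff : ∀ σ ∈ involutions n, ∀ τ ∈ involutions n, ∀ w : Fin k ⊕ Fin k ↪ Fin n,
      IsAltCycle σ τ w ↔ (∀ a, σ (w a) = w (θ₁ a)) ∧ ∀ a, τ (w a) = w (θ₂ a) := by
    intro σ hσ τ hτ w
    rw [mem_involutions] at hσ hτ
    constructor
    · intro hw
      constructor
      · rintro (i | i)
        · exact hw.1 i
        · exact hw.apply_left_inr hσ i
      · rintro (i | i)
        · exact hw.apply_right_inl hτ i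
        · exact hw.2 i
    · intro hw
      exact ⟨fun i => hw.1 (Sum.inl i), fun i => hw.2 (Sum.inr i)⟩
  calc _ = ∑ σ ∈ involutions n, ∑ τ ∈ involutions n, ∑ w : Fin k ⊕ Fin k ↪ Fin n,
        (if ∀ a, σ (w a) = w (θ₁ a) then 1 else 0) * (if ∀ a, τ (w a) = w (θ₂ a) then 1 else 0) := by
        refine Finset.sum_congr rfl fun σ hσ => Finset.sum_congr rfl fun τ hτ => ?_
        rw [Finset.card_filter]
        refine Finset.sum_congr rfl fun w _ => ?_
        rw [if_congr (hiff σ hσ τ hτ w) rfl rfl, ite_and, ite_mul, one_mul, zero_mul]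
    _ = ∑ w : Fin k ⊕ Fin k ↪ Fin n,
        (∑ σ ∈ involutions n, (if ∀ a, σ (w a) = w (θ₁ a) then 1 else 0)) *
          ∑ τ ∈ involutions n, (if ∀ a, τ (w a) = w (θ₂ a) then 1 else 0) := by
        rw [Finset.sum_congr rfl fun σ _ => Finset.sum_comm, Finset.sum_comm]
        refine Finset.sum_congr rfl fun w _ => ?_
        rw [Finset.sum_mul_sum]
    _ = _ := by
        simp only [← Finset.card_filter, card_involutions_extending _ _ h₁,
          card_involutions_extending _ _ h₂, hcard, Finset.sum_const, Finset.card_univ,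
          Fintype.card_embedding_eq, Fintype.card_fin, smul_eq_mul, sq]

theorem pairMean_numPaths (n : ℕ) :
    pairMean n (fun σ τ => numPaths σ τ) =
      n * involutionCount (n - 1) / involutionCount n := by
  have h : (involutionCount n : ℝ) ≠ 0 := by exact_mod_cast (involutionCount_pos n).ne'
  have h1 := congrArg (Nat.cast (R := ℝ)) (sum_numPaths n)
  push_cast at h1
  rw [pairMean, h1, ← involutionCount]
  field_simp

theorem pairMean_numCycles (n : ℕ) :
    pairMean n (fun σ τ => numCycles σ τ) =
      ∑ k ∈ Finset.Icc 1 (n / 2), (2 * (k : ℝ))⁻¹ *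
        (n.descFactorial (2 * k) * (involutionCount (n - 2 * k) : ℝ) ^ 2 /
          (involutionCount n : ℝ) ^ 2) := by
  classical
  rw [pairMean, ← involutionCount]
  have h : ∑ σ ∈ involutions n, ∑ τ ∈ involutions n, (numCycles σ τ : ℝ) =
      ∑ k ∈ Finset.Icc 1 (n / 2), (2 * (k : ℝ))⁻¹ *
        (n.descFactorial (2 * k) * (involutionCount (n - 2 * k) : ℝ) ^ 2) := by
    rw [Finset.sum_congr rfl fun σ hσ => Finset.sum_congr rfl fun τ hτ =>
      numCycles_eq_sum_isAltCycle (mem_involutions.1 hσ) (mem_involutions.1 hτ)]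
    rw [Finset.sum_congr rfl fun σ _ => Finset.sum_comm, Finset.sum_comm]
    refine Finset.sum_congr rfl fun k _ => ?_
    have := congrArg (Nat.cast (R := ℝ)) (sum_card_isAltCycle n k)
    push_cast at this
    rw [← this]
    simp only [Finset.mul_sum]
  rw [h, Finset.sum_div]
  exact Finset.sum_congr rfl fun k _ => by ring

theorem pairMean_numPermCycles (n : ℕ) :
    pairMean n (fun σ τ => numPermCycles (τ * σ)) =
      pairMean n (fun σ τ => numPaths σ τ) + 2 * pairMean n (fun σ τ => numCycles σ τ) := by
  rw [pairMean, pairMean, pairMean, mul_div_assoc', ← add_div]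
  congr 1
  simp only [Finset.mul_sum, ← Finset.sum_add_distrib]
  refine Finset.sum_congr rfl fun σ hσ => Finset.sum_congr rfl fun τ hτ => ?_
  rw [numPermCycles_mul (mem_involutions.1 hσ) (mem_involutions.1 hτ)]
  push_cast
  rfl

end Counting

/-! ### Asymptotics of the means -/

section Asymptotic

/-- By the recursion, r(m+1) = 1 + (m+1)/r(m) for r(m) = t(m+1)/t(m), so each bound at m yields the
opposite one at m + 1. -/
theorem involutionCount_succ_bounds (m : ℕ) :
    √(m + 1 : ℝ) * involutionCount m ≤ involutionCount (m + 1) ∧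
      (involutionCount (m + 1) : ℝ) ≤ (√(m + 1 : ℝ) + 1) * involutionCount m := by
  induction m with
  | zero => simp [involutionCount_zero, involutionCount_one]
  | succ m ih =>
    obtain ⟨h1, h2⟩ := ih
    have h0 : (0 : ℝ) < involutionCount m := by exact_mod_cast involutionCount_pos m
    have h0' : (0 : ℝ) < involutionCount (m + 1) := by exact_mod_cast involutionCount_pos (m + 1)
    rw [involutionCount_add_two]
    push_cast
    have hs : √(m + 1 : ℝ) ^ 2 = m + 1 := Real.sq_sqrt (by positivity)
    have ht : √(m + 1 + 1 : ℝ) ^ 2 = m + 1 + 1 := Real.sq_sqrt (by positivity)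
    have hst : √(m + 1 : ℝ) ≤ √(m + 1 + 1 : ℝ) := Real.sqrt_le_sqrt (by linarith)
    have hs0 : 0 ≤ √(m + 1 : ℝ) := Real.sqrt_nonneg _
    have ht1 : 1 ≤ √(m + 1 + 1 : ℝ) := Real.one_le_sqrt.2 (by linarith [m.cast_nonneg (α := ℝ)])
    generalize √(m + 1 : ℝ) = s at *
    generalize √(m + 1 + 1 : ℝ) = t at *
    generalize (involutionCount m : ℝ) = a at *
    generalize (involutionCount (m + 1) : ℝ) = b at *
    rw [← hs]
    constructor
    -- As t² = s² + 1, the squares of the two sides differ by exactly s².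
    · have h3 : t * (s + 1) ≤ s ^ 2 + s + 1 := by
        apply le_of_sq_le_sq _ (by positivity)
        rw [mul_pow, ht, ← hs]
        nlinarith
      have h4 : (t - 1) * b ≤ (t - 1) * ((s + 1) * a) :=
        mul_le_mul_of_nonneg_left h2 (by linarith)
      nlinarith
    · nlinarith

theorem abs_pairMean_numPaths_sub_le {n : ℕ} (hn : 0 < n) :
    |pairMean n (fun σ τ => numPaths σ τ) - √n| ≤ 1 := by
  obtain ⟨m, rfl⟩ := Nat.exists_eq_succ_of_ne_zero hn.ne'
  rw [pairMean_numPaths]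
  simp only [Nat.succ_eq_add_one, Nat.add_sub_cancel, Nat.cast_add, Nat.cast_one]
  obtain ⟨h1, h2⟩ := involutionCount_succ_bounds m
  have h0 : (0 : ℝ) < involutionCount m := by exact_mod_cast involutionCount_pos m
  have h0' : (0 : ℝ) < involutionCount (m + 1) := by exact_mod_cast involutionCount_pos (m + 1)
  have hs : √(m + 1 : ℝ) ^ 2 = m + 1 := Real.sq_sqrt (by positivity)
  have hs1 : 1 ≤ √(m + 1 : ℝ) := Real.one_le_sqrt.2 (by linarith [m.cast_nonneg (α := ℝ)])
  generalize √(m + 1 : ℝ) = s at *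
  rw [← hs, abs_le]
  constructor
  · rw [neg_le_sub_iff_le_add, ← sub_le_iff_le_add, le_div_iff₀ h0']
    nlinarith [mul_le_mul_of_nonneg_left h2 (sub_nonneg.2 hs1)]
  · rw [sub_le_iff_le_add, div_le_iff₀ h0']
    nlinarith

/-- The ratio `a (m - 2) / a m` for `a m = (involutionCount m) ^ 2 / m !`. -/
noncomputable def weightRatio (m : ℕ) : ℝ :=
  m * (m - 1) * (involutionCount (m - 2) : ℝ) ^ 2 / (involutionCount m : ℝ) ^ 2

/-- With s = √m, u = √(m-1) and r = t(m-1)/t(m-2), the ratio is s²u²/(r + u²)². The upper bounds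
take r ≥ u, the lower one r ≤ u + 1 and u² + u + 1 ≤ s(s + 1). The first two bounds give the
expansion in 1/√m; the third gives uniform geometric decay. -/
theorem weightRatio_bounds {m : ℕ} (hm : 2 ≤ m) :
    1 - 2 / √m ≤ weightRatio m ∧ weightRatio m ≤ 1 - 2 / √m + 8 / m ∧
      weightRatio m ≤ 1 - 1 / (√m + 1) := by
  obtain ⟨j, rfl⟩ := Nat.exists_eq_add_of_le' hm
  obtain ⟨h1, h2⟩ := involutionCount_succ_bounds j
  have ha : (0 : ℝ) < involutionCount j := by exact_mod_cast involutionCount_pos j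
  have hs : √((j + 2 : ℕ) : ℝ) ^ 2 = ((j + 2 : ℕ) : ℝ) := Real.sq_sqrt (by positivity)
  have hu : √(j + 1 : ℝ) ^ 2 = j + 1 := Real.sq_sqrt (by positivity)
  have hu1 : 1 ≤ √(j + 1 : ℝ) := Real.one_le_sqrt.2 (by linarith [j.cast_nonneg (α := ℝ)])
  have hus : √(j + 1 : ℝ) ≤ √((j + 2 : ℕ) : ℝ) :=
    Real.sqrt_le_sqrt (by push_cast; linarith)
  have hs2 : √((j + 2 : ℕ) : ℝ) ^ 2 = √(j + 1 : ℝ) ^ 2 + 1 := by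
    rw [hs, hu]; push_cast; ring
  have hdef : weightRatio (j + 2) =
      (√((j + 2 : ℕ) : ℝ) ^ 2 * √(j + 1 : ℝ) ^ 2 * (involutionCount j : ℝ) ^ 2) /
        (involutionCount (j + 1) + √(j + 1 : ℝ) ^ 2 * involutionCount j) ^ 2 := by
    rw [weightRatio, Nat.add_sub_cancel, involutionCount_add_two, hs, hu]
    push_cast
    ring_nf
  rw [hdef]
  generalize √((j + 2 : ℕ) : ℝ) = s at *
  generalize √(j + 1 : ℝ) = u at *
  generalize (involutionCount j : ℝ) = a at *
  generalize (involutionCount (j + 1) : ℝ) = b at *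
  rw [← hs]
  have hs1 : 1 ≤ s := hu1.trans hus
  have hb : 0 < b := by nlinarith
  have hup : s ^ 2 * u ^ 2 * a ^ 2 / (b + u ^ 2 * a) ^ 2 ≤ 1 - 2 * u / (u + 1) ^ 2 := by
    calc s ^ 2 * u ^ 2 * a ^ 2 / (b + u ^ 2 * a) ^ 2
        ≤ s ^ 2 * u ^ 2 * a ^ 2 / (u * a + u ^ 2 * a) ^ 2 := by gcongr
      _ = 1 - 2 * u / (u + 1) ^ 2 := by
          rw [hs2]; field_simp; ring
  refine ⟨?_, hup.trans ?_, hup.trans ?_⟩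
  · calc 1 - 2 / s ≤ 1 - 2 / (s + 1) := by gcongr; linarith
      _ = s ^ 2 * u ^ 2 * a ^ 2 / (s * (s + 1) * a) ^ 2 := by
          rw [show u ^ 2 = (s - 1) * (s + 1) by linarith]
          field_simp
          ring
      _ ≤ _ := by
          gcongr
          nlinarith
  · have h3 : 2 / u - 4 / u ^ 2 ≤ 2 * u / (u + 1) ^ 2 := by
      rw [show 2 / u - 4 / u ^ 2 = (2 * u - 4) / u ^ 2 by field_simp,
        div_le_div_iff₀ (by positivity) (by positivity)]
      nlinarith
    have h4 : 2 / s ≤ 2 / u := by gcongr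
    have h5 : 4 / u ^ 2 ≤ 8 / s ^ 2 := by
      rw [div_le_div_iff₀ (by positivity) (by positivity)]
      nlinarith
    linarith
  · have h3 : 1 / (s + 1) ≤ 2 * u / (u + 1) ^ 2 := by
      rw [div_le_div_iff₀ (by positivity) (by positivity)]
      nlinarith
    linarith

/-- The relative weight of the pairs of involutions with a marked rooted cycle of length `2 k`. -/
noncomputable def cycleWeight (n k : ℕ) : ℝ :=
  n.descFactorial (2 * k) * (involutionCount (n - 2 * k) : ℝ) ^ 2 / (involutionCount n : ℝ) ^ 2

theorem cycleWeight_zero (n : ℕ) : cycleWeight n 0 = 1 := by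
  have h : (involutionCount n : ℝ) ≠ 0 := by exact_mod_cast (involutionCount_pos n).ne'
  simp [cycleWeight, h]

theorem cycleWeight_nonneg (n k : ℕ) : 0 ≤ cycleWeight n k := by
  unfold cycleWeight
  positivity

theorem cycleWeight_succ {n k : ℕ} (h : 2 * (k + 1) ≤ n) :
    cycleWeight n (k + 1) = cycleWeight n k * weightRatio (n - 2 * k) := by
  obtain ⟨m, rfl⟩ := Nat.exists_eq_add_of_le' h
  have h1 : (involutionCount (m + 2) : ℝ) ≠ 0 := by exact_mod_cast (involutionCount_pos _).ne'
  have h2 : m + 2 * (k + 1) - 2 * k = m + 2 := by omega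
  have h3 : m + 2 * (k + 1) - (2 * k + 1) = m + 1 := by omega
  rw [cycleWeight, cycleWeight, weightRatio, h2, Nat.add_sub_cancel, Nat.add_sub_cancel,
    show 2 * (k + 1) = 2 * k + 1 + 1 by ring, Nat.descFactorial_succ, Nat.descFactorial_succ,
    show m + (2 * k + 1 + 1) = m + 2 * (k + 1) by ring, h2, h3]
  push_cast
  field_simp
  ring

theorem abs_weightRatio_sub_le {n i : ℕ} (hn : 4 ≤ n) (hi : 2 * (i + 1) ≤ n) :
    |weightRatio (n - 2 * i) - (1 - 2 / √n)| ≤ 20 * (1 / n + (i : ℝ) ^ 2 / (n : ℝ) ^ 2) := by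
  obtain ⟨h1, h2, h3⟩ := weightRatio_bounds (m := n - 2 * i) (by omega)
  have hsq : √((n - 2 * i : ℕ) : ℝ) ^ 2 = ((n - 2 * i : ℕ) : ℝ) := Real.sq_sqrt (by positivity)
  have hNq : √(n : ℝ) ^ 2 = n := Real.sq_sqrt (by positivity)
  have hcast : ((n - 2 * i : ℕ) : ℝ) = n - 2 * i := by
    rw [Nat.cast_sub (by omega)]; push_cast; ring
  have hN2 : 2 ≤ √(n : ℝ) := by
    apply Real.le_sqrt_of_sq_le
    have : ((4 : ℕ) : ℝ) ≤ n := by exact_mod_cast hn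
    norm_num at this ⊢
    exact this
  have hs1 : 1 ≤ √((n - 2 * i : ℕ) : ℝ) := Real.one_le_sqrt.2 (by
    have : 1 ≤ n - 2 * i := by omega
    exact_mod_cast this)
  have hsN : √((n - 2 * i : ℕ) : ℝ) ≤ √(n : ℝ) :=
    Real.sqrt_le_sqrt (by rw [hcast]; linarith [i.cast_nonneg (α := ℝ)])
  have hi0 : (0 : ℝ) ≤ i := i.cast_nonneg
  have hp0 : 0 ≤ weightRatio (n - 2 * i) := by
    have : 1 ≤ n - 2 * i := by omega
    have : (1 : ℝ) ≤ ((n - 2 * i : ℕ) : ℝ) := by exact_mod_cast this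
    have : 0 ≤ ((n - 2 * i : ℕ) : ℝ) - 1 := by linarith
    unfold weightRatio
    positivity
  generalize weightRatio (n - 2 * i) = p at *
  -- For 4i ≤ n, √(n-2i) ≥ √n/2, and 2/√(n-2i) - 2/√n ≤ 8(i/n)(1/√n) is split by AM-GM; 20 = 16 + 4.
  -- Otherwise i²/n² ≥ 1/16 and the bound exceeds 1, while both compared quantities lie in [0, 1].
  have hcase : (4 * (i : ℝ) ≤ n) ∨ ((n : ℝ) ≤ 4 * i) := le_total _ _
  generalize √((n - 2 * i : ℕ) : ℝ) = s at *
  generalize √(n : ℝ) = N at *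
  generalize (i : ℝ) = x at *
  rw [← hsq] at h2
  rw [hcast, ← hNq] at hsq
  rw [← hNq] at hcase ⊢
  rcases hcase with hx | hx
  · have hsN2 : N / 2 ≤ s := by nlinarith
    have h4 : 8 / s ^ 2 ≤ 16 / N ^ 2 := by
      rw [div_le_div_iff₀ (by positivity) (by positivity)]
      nlinarith
    have h5 : 2 / s - 2 / N ≤ 4 * (1 / N ^ 2 + x ^ 2 / (N ^ 2) ^ 2) := by
      have e1 : 2 / s - 2 / N = 4 * x / ((N + s) * s * N) := by
        have : 4 * x = 2 * ((N + s) * (N - s)) := by nlinarith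
        rw [this]
        field_simp
      have e2 : 4 * x / ((N + s) * s * N) ≤ 4 * x / (N * (N / 2) * N) := by
        gcongr
        linarith
      have e3 : 4 * x / (N * (N / 2) * N) = 8 * (x / N ^ 2) * (1 / N) := by
        field_simp
        ring
      have e4 : 1 / N ^ 2 + x ^ 2 / (N ^ 2) ^ 2 = (1 / N) ^ 2 + (x / N ^ 2) ^ 2 := by
        field_simp
      rw [e1, e4]
      rw [e3] at e2
      nlinarith [sq_nonneg (1 / N - x / N ^ 2)]
    have h6 : 2 / N ≤ 2 / s := by gcongr
    have h7 : 0 ≤ x ^ 2 / (N ^ 2) ^ 2 := by positivity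
    have h8 : 0 ≤ 8 / s ^ 2 := by positivity
    have h9 : 16 / N ^ 2 = 16 * (1 / N ^ 2) := by ring
    rw [abs_le]
    constructor <;> linarith
  · have h4 : 1 / 16 ≤ x ^ 2 / (N ^ 2) ^ 2 := by
      rw [div_le_div_iff₀ (by positivity) (by positivity)]
      nlinarith
    have h5 : 0 ≤ 1 / N ^ 2 := by positivity
    have h6 : 2 / N ≤ 1 := by rw [div_le_one (by positivity)]; exact hN2
    have h7 : 0 ≤ 2 / N := by positivity
    have h8 : 0 ≤ 1 / (s + 1) := by positivity
    rw [abs_le]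
    constructor <;> linarith

/-- Replace the factors of the product by z = 1 - 2/√n one at a time; y = 1 - 1/(√n + 1) dominates
both z and every ratio. The constant is 40 = 2 · 20 because y ≥ 1/2 lets y^k be absorbed into
2y^{k+1}. -/
theorem cycleWeight_bounds {n : ℕ} (hn : 4 ≤ n) (k : ℕ) (hk : 2 * k ≤ n) :
    cycleWeight n k ≤ (1 - 1 / (√n + 1)) ^ k ∧
      |cycleWeight n k - (1 - 2 / √n) ^ k| ≤
        40 * k * (1 - 1 / (√n + 1)) ^ k * (1 / n + (k : ℝ) ^ 2 / (n : ℝ) ^ 2) := by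
  have hN2 : 2 ≤ √(n : ℝ) := by
    apply Real.le_sqrt_of_sq_le
    have : ((4 : ℕ) : ℝ) ≤ n := by exact_mod_cast hn
    norm_num at this ⊢
    exact this
  have hz0 : 0 ≤ 1 - 2 / √(n : ℝ) := by
    rw [sub_nonneg, div_le_one (by positivity)]; exact hN2
  have hzy : 1 - 2 / √(n : ℝ) ≤ 1 - 1 / (√(n : ℝ) + 1) := by
    gcongr
    · norm_num
    · linarith
  have hy : 1 / 2 ≤ 1 - 1 / (√(n : ℝ) + 1) := by
    have : 1 / (√(n : ℝ) + 1) ≤ 1 / 2 := by gcongr; linarith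
    linarith
  induction k with
  | zero => simp [cycleWeight_zero]
  | succ k ih =>
    obtain ⟨h1, h2⟩ := ih (by omega)
    have h3 := abs_weightRatio_sub_le hn hk
    have hb0 := cycleWeight_nonneg n k
    have hpy : weightRatio (n - 2 * k) ≤ 1 - 1 / (√(n : ℝ) + 1) := by
      refine (weightRatio_bounds (by omega)).2.2.trans ?_
      gcongr
      omega
    rw [cycleWeight_succ hk]
    have hD : (1 / n + (k : ℝ) ^ 2 / (n : ℝ) ^ 2) ≤
        (1 / n + ((k + 1 : ℕ) : ℝ) ^ 2 / (n : ℝ) ^ 2) := by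
      gcongr
      omega
    have hD0 : 0 ≤ (1 / n + (k : ℝ) ^ 2 / (n : ℝ) ^ 2) := by positivity
    generalize (1 / n + (k : ℝ) ^ 2 / (n : ℝ) ^ 2) = D at *
    generalize (1 / n + ((k + 1 : ℕ) : ℝ) ^ 2 / (n : ℝ) ^ 2) = D' at *
    generalize 1 - 1 / (√(n : ℝ) + 1) = y at *
    generalize 1 - 2 / √(n : ℝ) = z at *
    generalize weightRatio (n - 2 * k) = p at *
    generalize cycleWeight n k = b at *
    have hyk : 0 ≤ y ^ k := by positivity
    constructor
    · rw [pow_succ]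
      by_cases hp : 0 ≤ p
      · exact mul_le_mul h1 hpy hp hyk
      · exact (mul_nonpos_of_nonneg_of_nonpos hb0 (not_le.1 hp).le).trans (by positivity)
    · calc |b * p - z ^ (k + 1)| = |b * (p - z) + z * (b - z ^ k)| := by ring_nf
        _ ≤ b * |p - z| + z * |b - z ^ k| := by
            refine (abs_add_le _ _).trans_eq ?_
            rw [abs_mul, abs_mul, abs_of_nonneg hb0, abs_of_nonneg hz0]
        _ ≤ y ^ k * (20 * D) + y * (40 * k * y ^ k * D) := by
            gcongr
        _ ≤ (2 * y) * (y ^ k * (20 * D)) + y * (40 * k * y ^ k * D) := by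
            have : 0 ≤ y ^ k * (20 * D) := by positivity
            nlinarith
        _ = 40 * ((k + 1 : ℕ) : ℝ) * y ^ (k + 1) * D := by push_cast; ring
        _ ≤ _ := by gcongr

theorem sum_pow_le {y : ℝ} (h0 : 0 ≤ y) (h1 : y < 1) (s : Finset ℕ) :
    ∑ k ∈ s, y ^ k ≤ 1 / (1 - y) := by
  rw [one_div]
  exact sum_le_hasSum s (fun _ _ => by positivity) (hasSum_geometric_of_lt_one h0 h1)

/-- Compare with the negative binomial series: k² ≤ (k+1)(k+2). -/
theorem sum_sq_mul_pow_le {y : ℝ} (h0 : 0 ≤ y) (h1 : y < 1) (s : Finset ℕ) :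
    ∑ k ∈ s, (k : ℝ) ^ 2 * y ^ k ≤ 2 * (1 / (1 - y) ^ 3) := by
  have h := hasSum_choose_mul_geometric_of_norm_lt_one (𝕜 := ℝ) 2
    (by rwa [Real.norm_of_nonneg h0] : ‖y‖ < 1)
  refine le_trans ?_ (mul_le_mul_of_nonneg_left (sum_le_hasSum s (fun _ _ => by positivity) h)
    zero_le_two)
  rw [Finset.mul_sum]
  refine Finset.sum_le_sum fun k _ => ?_
  rw [← mul_assoc]
  gcongr
  rw [Nat.cast_choose_two]
  push_cast
  nlinarith [k.cast_nonneg (α := ℝ)]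

/-- Truncating the series `∑ z ^ k / k = -log (1 - z)`. -/
theorem abs_sum_pow_div_sub_log_le {z : ℝ} (h0 : 0 ≤ z) (h1 : z < 1) (M : ℕ) :
    |∑ k ∈ Finset.Icc 1 M, z ^ k / k - -Real.log (1 - z)| ≤ 1 / (M + 1) * (1 / (1 - z)) := by
  have h := Real.hasSum_pow_div_log_of_abs_lt_one (x := z) (by rwa [abs_of_nonneg h0])
  have hr : ∑ k ∈ Finset.Icc 1 M, z ^ k / k = ∑ i ∈ Finset.range M, z ^ (i + 1) / ((i : ℝ) + 1) := by
    have hI : Finset.Icc 1 M = Finset.Ico (0 + 1) (M + 1) := by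
      ext k
      simp only [Finset.mem_Icc, Finset.mem_Ico]
      omega
    rw [hI, ← Finset.sum_Ico_add', Finset.range_eq_Ico]
    push_cast
    rfl
  have ht := (hasSum_nat_add_iff' M).2 h
  rw [hr, abs_sub_comm, abs_of_nonneg (ht.nonneg fun i => by positivity), one_div (1 - z)]
  refine hasSum_le (fun i => ?_) ht ((hasSum_geometric_of_lt_one h0 h1).mul_left (1 / (M + 1 : ℝ)))
  rw [div_mul_eq_mul_div, one_mul]
  push_cast
  gcongr ?_ / ?_
  · exact pow_le_pow_of_le_one h0 h1.le (by omega)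
  · linarith [i.cast_nonneg (α := ℝ)]

theorem abs_pairMean_numCycles_sub_le {n : ℕ} (hn : 4 ≤ n) :
    |pairMean n (fun σ τ => numCycles σ τ) - (1 / 4 * Real.log n - 1 / 2 * Real.log 2)| ≤
      361 / √n := by
  have hN2 : 2 ≤ √(n : ℝ) := by
    apply Real.le_sqrt_of_sq_le
    have : ((4 : ℕ) : ℝ) ≤ n := by exact_mod_cast hn
    norm_num at this ⊢
    exact this
  have hNq : √(n : ℝ) ^ 2 = n := Real.sq_sqrt (by positivity)
  have hz0 : 0 ≤ 1 - 2 / √(n : ℝ) := by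
    rw [sub_nonneg, div_le_one (by positivity)]; exact hN2
  have hz1 : 1 - 2 / √(n : ℝ) < 1 := by
    have : 0 < 2 / √(n : ℝ) := by positivity
    linarith
  have hy1 : 1 - 1 / (√(n : ℝ) + 1) < 1 := by
    have : 0 < 1 / (√(n : ℝ) + 1) := by positivity
    linarith
  have hy0 : 0 ≤ 1 - 1 / (√(n : ℝ) + 1) := by
    rw [sub_nonneg, div_le_one (by positivity)]; linarith
  have hlog : 1 / 4 * Real.log n - 1 / 2 * Real.log 2 =
      1 / 2 * -Real.log (1 - (1 - 2 / √(n : ℝ))) := by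
    rw [sub_sub_cancel, Real.log_div (by norm_num) (by positivity), Real.log_sqrt (by positivity)]
    ring
  have htail := abs_sum_pow_div_sub_log_le hz0 hz1 (n / 2)
  -- The factor k in the error bound cancels against 1/(2k), leaving geometric sums with 1/(1 - y) =
  -- √n + 1 ≤ 2√n; 360 = 20(2 + 16).
  have hmain : |∑ k ∈ Finset.Icc 1 (n / 2), (2 * (k : ℝ))⁻¹ * cycleWeight n k -
      1 / 2 * ∑ k ∈ Finset.Icc 1 (n / 2), (1 - 2 / √(n : ℝ)) ^ k / k| ≤ 360 / √n := by
    rw [Finset.mul_sum, ← Finset.sum_sub_distrib]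
    calc _ ≤ ∑ k ∈ Finset.Icc 1 (n / 2), 20 * ((1 / (n : ℝ)) * (1 - 1 / (√(n : ℝ) + 1)) ^ k +
          1 / (n : ℝ) ^ 2 * ((k : ℝ) ^ 2 * (1 - 1 / (√(n : ℝ) + 1)) ^ k)) := by
          refine (Finset.abs_sum_le_sum_abs _ _).trans (Finset.sum_le_sum fun k hk => ?_)
          rw [Finset.mem_Icc] at hk
          have hk0 : (0 : ℝ) < k := by exact_mod_cast hk.1
          have h := (cycleWeight_bounds hn k (by omega)).2
          rw [show (2 * (k : ℝ))⁻¹ * cycleWeight n k - 1 / 2 * ((1 - 2 / √(n : ℝ)) ^ k / k) =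
            (2 * (k : ℝ))⁻¹ * (cycleWeight n k - (1 - 2 / √(n : ℝ)) ^ k) by field_simp,
            abs_mul, abs_of_pos (by positivity : 0 < (2 * (k : ℝ))⁻¹)]
          refine (mul_le_mul_of_nonneg_left h (by positivity)).trans_eq ?_
          generalize (1 - 1 / (√(n : ℝ) + 1)) ^ k = Y
          field_simp
          ring
      _ = 20 * (1 / n * ∑ k ∈ Finset.Icc 1 (n / 2), (1 - 1 / (√(n : ℝ) + 1)) ^ k +
          1 / (n : ℝ) ^ 2 *
            ∑ k ∈ Finset.Icc 1 (n / 2), (k : ℝ) ^ 2 * (1 - 1 / (√(n : ℝ) + 1)) ^ k) := by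
          rw [← Finset.mul_sum, Finset.sum_add_distrib, Finset.mul_sum, Finset.mul_sum]
      _ ≤ 20 * (1 / n * (1 / (1 - (1 - 1 / (√(n : ℝ) + 1)))) +
          1 / (n : ℝ) ^ 2 * (2 * (1 / (1 - (1 - 1 / (√(n : ℝ) + 1))) ^ 3))) := by
          gcongr
          · exact sum_pow_le hy0 hy1 _
          · exact sum_sq_mul_pow_le hy0 hy1 _
      _ = 20 * ((√(n : ℝ) + 1) / √(n : ℝ) ^ 2 + 2 * (√(n : ℝ) + 1) ^ 3 / (√(n : ℝ) ^ 2) ^ 2) := by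
          rw [sub_sub_cancel, hNq]
          field_simp
      _ ≤ 20 * ((2 * √(n : ℝ)) / √(n : ℝ) ^ 2 +
            2 * (2 * √(n : ℝ)) ^ 3 / (√(n : ℝ) ^ 2) ^ 2) := by
          gcongr <;> linarith
      _ = 360 / √n := by
          field_simp
          norm_num
  have htail' : 1 / ((n / 2 : ℕ) + 1 : ℝ) * (1 / (1 - (1 - 2 / √(n : ℝ)))) ≤ 1 / √n := by
    have h1 : (n : ℝ) / 2 ≤ (n / 2 : ℕ) + 1 := by
      have : n ≤ 2 * (n / 2 + 1) := by omega
      have : (n : ℝ) ≤ 2 * ((n / 2 : ℕ) + 1) := by exact_mod_cast this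
      linarith
    calc _ ≤ 1 / ((n : ℝ) / 2) * (1 / (1 - (1 - 2 / √(n : ℝ)))) := by
          gcongr
      _ = 1 / √n := by
          rw [sub_sub_cancel]
          generalize √(n : ℝ) = N at *
          rw [← hNq]
          field_simp
  rw [pairMean_numCycles, hlog]
  change |∑ k ∈ Finset.Icc 1 (n / 2), (2 * (k : ℝ))⁻¹ * cycleWeight n k - _| ≤ _
  have h361 : 361 / √(n : ℝ) = 360 / √n + 1 / √n := by ring
  have hpos : 0 < 1 / √(n : ℝ) := by positivity
  rw [abs_le] at *
  constructor <;> linarith [htail.1, htail.2, hmain.1, hmain.2]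

end Asymptotic

theorem mainTheorem3 :
    ((fun n : ℕ => pairMean n (fun σ τ => numPermCycles (τ * σ)) -
        (Real.sqrt n + 1 / 2 * Real.log n)) =O[atTop] (fun _ => (1 : ℝ))) ∧
    ((fun n : ℕ => pairMean n (fun σ τ => numPaths σ τ) - Real.sqrt n)
        =O[atTop] (fun _ => (1 : ℝ))) ∧
    ((fun n : ℕ => pairMean n (fun σ τ => numCycles σ τ) -
        (1 / 4 * Real.log n - 1 / 2 * Real.log 2))
        =O[atTop] (fun n : ℕ => Real.log n / Real.sqrt n)) := by
  have hcyc : ∀ n : ℕ, 4 ≤ n → 361 / √(n : ℝ) ≤ 361 := by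
    intro n hn
    have h1 : 1 ≤ √(n : ℝ) := Real.one_le_sqrt.2 (by exact_mod_cast (by omega : 1 ≤ n))
    exact div_le_self (by norm_num) h1
  -- The first constant covers 1 + 2 · 361 + log 2, where log 2 is the doubled constant term of item
  -- 3.
  refine ⟨IsBigO.of_bound 724 ?_, IsBigO.of_bound 1 ?_, IsBigO.of_bound 361 ?_⟩
  · filter_upwards [eventually_ge_atTop 4] with n hn
    have h1 := abs_pairMean_numPaths_sub_le (n := n) (by omega)
    have h2 := (abs_pairMean_numCycles_sub_le hn).trans (hcyc n hn)
    have h3 := Real.log_two_lt_d9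
    have h4 := Real.log_two_gt_d9
    rw [pairMean_numPermCycles, Real.norm_eq_abs, norm_one, mul_one]
    rw [abs_le] at *
    constructor <;> linarith [h1.1, h1.2, h2.1, h2.2]
  · filter_upwards [eventually_ge_atTop 4] with n hn
    rw [Real.norm_eq_abs, norm_one, mul_one]
    exact abs_pairMean_numPaths_sub_le (by omega)
  · filter_upwards [eventually_ge_atTop 4] with n hn
    refine (abs_pairMean_numCycles_sub_le hn).trans ?_
    have hn4 : (4 : ℝ) ≤ n := by exact_mod_cast hn
    have hlog : 1 ≤ Real.log n := by
      rw [Real.le_log_iff_exp_le (by linarith)]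
      linarith [Real.exp_one_lt_d9]
    rw [Real.norm_of_nonneg (by positivity), mul_div_assoc']
    gcongr
    linarith
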